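/- Let $k$ be a field of characteristic $0$. \textbf{Rooted trees.} A rooted tree is a finite poset with a greatest element (the root) in which the elements above any given one form a chain; rooted trees are taken up to isomorphism, $|t|$ is the number of vertices of $t$, and $\mathrm{Sym}(t)$ is its group of poset automorphisms. A forest is a finite multiset (commutative monomial) $u=t_1\cdots t_n$ of rooted trees, $|u|=\sum_i|t_i|$, and $B_+(u)$ is the rooted tree obtained by attaching $t_1,\dots,t_n$ to a new root; $B_+(1)=\bullet$. Let $k\mathcal T$ be the vector space with the rooted trees as basis, with the Grossman–Larson product $\circ$: for $t=B_+(t_1\cdots t_n)$, $t\circ t'$ is the sum of the $|t'|^n$ trees obtained by attaching each $t_i$ to some vertex of $t'$. Let $(\cdot,\cdot)$ be the bilinear form on $k\mathcal T$ with $(t,t)=|\mathrm{Sym}(t)|$ and $(t,t')=0$ for $t\ne t'$. Put $$\kappa_n=\sum_{|t|=n+1}\frac{t}{|\mathrm{Sym}(t)|},\qquad \epsilon_0=\bullet,\qquad \epsilon_n=\sum_{i=1}^{n}(-1)^{i-1}\kappa_i\circ\epsilon_{n-i}\quad(n\ge 1).$$ The Connes–Kreimer algebra $\mathcal H_K$ is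 the polynomial algebra over $k$ on the rooted trees. Its monomials are the forests, and $B_+$ is extended to linear maps $\mathcal H_K\to k\mathcal T$ and $\mathcal H_K\to\mathcal H_K$. The algebras $k\mathcal T$ and $\mathcal H_K$ are paired by $\langle t,u\rangle=(t,B_+(u))$. \textbf{Quasi-symmetric functions.} $\mathrm{QSym}$ is the algebra of quasi-symmetric power series of bounded degree in $x_1,x_2,\dots$ over $k$; it has the basis $M_I=\sum_{n_1<\dots<n_l}x_{n_1}^{i_1}\cdots x_{n_l}^{i_l}$, indexed by the compositions $I=(i_1,\dots,i_l)$. $\mathrm{NSym}=k\langle E_1,E_2,\dots\rangle$ has the basis $E_I=E_{i_1}\cdots E_{i_l}$ and is paired with $\mathrm{QSym}$ by $\langle E_I,M_J\rangle=\delta_{I,J}$. Let $Z:\mathrm{NSym}\to k\mathcal T$ be the homomorphism with $Z(E_n)=\epsilon_n$, that is, $Z(E_I)=\epsilon_{i_1}\circ\cdots\circ\epsilon_{i_l}$ and $Z(1)=\bullet$. Let $Z^*:\mathcal H_K\to\mathrm{QSym}$ be its graded dual, $Z^*(u)=\sum_{|I|=|u|}\langle Z(E_I),u\rangle M_I$ for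 forests $u$. Let $\alpha_+:\mathrm{QSym}\to\mathrm{QSym}$ be the linear map with $\alpha_+(M_I)=M_{I\sqcup(1)}$, where $I\sqcup(1)=(i_1,\dots,i_l,1)$. \textbf{Theorem.} (0) $\langle P,Z^*(x)\rangle=\langle Z(P),x\rangle$ for all $P\in\mathrm{NSym}$ and $x\in\mathcal H_K$. (1) $Z^*(B_+(u))=\alpha_+(Z^*(u))$ for every forest $u$. (2) $Z^*$ is a homomorphism of unital $k$-algebras, and it is the only homomorphism of unital $k$-algebras $\rho:\mathcal H_K\to\mathrm{QSym}$ with $\rho(B_+(u))=\alpha_+(\rho(u))$ for all forests $u$. (3) $(\mathcal H_K,B_+)$ is initial among the pairs $(A,\lambda)$ of a commutative unital $k$-algebra $A$ and a $k$-linear map $\lambda:A\to A$: for every such pair there is exactly one homomorphism of unital $k$-algebras $\rho:\mathcal H_K\to A$ with $\rho\circ B_+=\lambda\circ\rho$. -/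

import Mathlib

noncomputable section

namespace ConnesKreimer

/-! ## Rooted trees -/

/-- Encodings of finite rooted trees (drawn in the plane): `leaf` is the one-vertex tree, and
`cons a t` is the tree `t` with one more child, carrying the tree `a`, attached to its root. -/
inductive PTree : Type
  | leaf : PTree
  | cons : PTree → PTree → PTree

/-- The vertices of an encoded tree: those of `cons a t` are the ones of `a` and of `t`. -/
inductive Vert : PTree → Type
  | pt : Vert PTree.leaf
  | inl {a t : PTree} : Vert a → Vert (PTree.cons a t)
  | inr {a t : PTree} : Vert t → Vert (PTree.cons a t)

namespace Vert

/-- The root vertex. -/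
def root : (t : PTree) → Vert t
  | .leaf => .pt
  | .cons _ t => .inr (root t)

/-- The tree order on the vertices, in which the root is the maximal vertex. -/
def le : {t : PTree} → Vert t → Vert t → Prop
  | _, .pt, .pt => True
  | _, .inl v, .inl w => le v w
  | _, .inl _, .inr w => w = root _
  | _, .inr _, .inl _ => False
  | _, .inr v, .inr w => le v w

theorem le_root' : {t : PTree} → (v : Vert t) → le v (root t)
  | _, .pt => trivial
  | _, .inl _ => rfl
  | _, .inr v => le_root' v

theorem le_refl' : {t : PTree} → (v : Vert t) → le v v
  | _, .pt => trivial
  | _, .inl v => le_refl' v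
  | _, .inr v => le_refl' v

theorem le_antisymm' : {t : PTree} → (v w : Vert t) → le v w → le w v → v = w
  | _, .pt, .pt, _, _ => rfl
  | _, .inl v, .inl w, h, h' => congrArg inl (le_antisymm' v w h h')
  | _, .inl _, .inr _, _, h' => h'.elim
  | _, .inr _, .inl _, h, _ => h.elim
  | _, .inr v, .inr w, h, h' => congrArg inr (le_antisymm' v w h h')

theorem le_trans' : {t : PTree} → (u v w : Vert t) → le u v → le v w → le u w
  | _, .pt, .pt, .pt, _, _ => trivial
  | _, .inl u, .inl v, .inl w, h, h' => le_trans' u v w h h'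
  | _, .inl _, .inl _, .inr _, _, h' => h'
  | _, .inl _, .inr _, .inl _, _, h' => h'.elim
  | _, .inl _, .inr v, .inr w, h, h' => by
      have h1 : v = root _ := h
      subst h1
      exact le_antisymm' _ _ (le_root' w) h'
  | _, .inr _, .inl _, _, h, _ => h.elim
  | _, .inr _, .inr _, .inl _, _, h' => h'.elim
  | _, .inr u, .inr v, .inr w, h, h' => le_trans' u v w h h'

instance (t : PTree) : PartialOrder (Vert t) where
  le := le
  le_refl := le_refl'
  le_trans := le_trans'
  le_antisymm := le_antisymm'

instance (t : PTree) : OrderTop (Vert t) where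
  top := root t
  le_top := le_root'

theorem inl_le_inl {a t : PTree} {v w : Vert a} :
    (inl v : Vert (.cons a t)) ≤ inl w ↔ v ≤ w := Iff.rfl

theorem inr_le_inr {a t : PTree} {v w : Vert t} :
    (inr v : Vert (.cons a t)) ≤ inr w ↔ v ≤ w := Iff.rfl

theorem inl_le_inr {a t : PTree} {v : Vert a} {w : Vert t} :
    (inl v : Vert (.cons a t)) ≤ inr w ↔ w = ⊤ := Iff.rfl

theorem not_inr_le_inl {a t : PTree} {v : Vert t} {w : Vert a} :
    ¬ (inr v : Vert (.cons a t)) ≤ inl w := id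

/-- The vertices of `cons a t` are the disjoint union of those of `a` and of `t`. -/
def sumEquiv (a t : PTree) : Vert a ⊕ Vert t ≃ Vert (.cons a t) where
  toFun := Sum.elim inl inr
  invFun
    | .inl v => Sum.inl v
    | .inr v => Sum.inr v
  left_inv := by rintro (v | v) <;> rfl
  right_inv := by rintro (v | v) <;> rfl

instance fintype : (t : PTree) → Fintype (Vert t)
  | .leaf => ⟨{.pt}, by rintro ⟨⟩; simp⟩
  | .cons a t =>
      letI := fintype a
      letI := fintype t
      Fintype.ofEquiv _ (sumEquiv a t)

theorem consIso_aux {a a' t t' : PTree} (e : Vert a ≃o Vert a') (f : Vert t ≃o Vert t') :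
    ∀ v w : Vert (.cons a t),
      sumEquiv a' t' (Sum.map e f ((sumEquiv a t).symm v)) ≤
        sumEquiv a' t' (Sum.map e f ((sumEquiv a t).symm w)) ↔ v ≤ w
  | .inl _, .inl _ => e.map_rel_iff
  | .inl _, .inr _ => map_eq_top_iff f
  | .inr _, .inl _ => Iff.rfl
  | .inr _, .inr _ => f.map_rel_iff

/-- Isomorphisms of the parts give an isomorphism of the whole. -/
def consIso {a a' t t' : PTree} (e : Vert a ≃o Vert a') (f : Vert t ≃o Vert t') :
    Vert (.cons a t) ≃o Vert (.cons a' t') where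
  toEquiv := (sumEquiv a t).symm.trans ((e.toEquiv.sumCongr f.toEquiv).trans (sumEquiv a' t'))
  map_rel_iff' := fun {v w} => consIso_aux e f v w

/-- Exchange of the first two children of the root. -/
def swap {a b t : PTree} : Vert (.cons a (.cons b t)) → Vert (.cons b (.cons a t))
  | .inl v => .inr (.inl v)
  | .inr (.inl v) => .inl v
  | .inr (.inr v) => .inr (.inr v)

theorem swap_swap {a b t : PTree} : ∀ v : Vert (.cons a (.cons b t)), swap (swap v) = v
  | .inl _ => rfl
  | .inr (.inl _) => rfl
  | .inr (.inr _) => rfl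

theorem swap_le {a b t : PTree} :
    ∀ v w : Vert (.cons a (.cons b t)), v ≤ w → swap v ≤ swap w
  | .inl _, .inl _, h => h
  | .inl _, .inr (.inl _), h => nomatch (inl_le_inr.1 h : inl _ = inr _)
  | .inl _, .inr (.inr _), h => inr.inj (inl_le_inr.1 h : inr _ = inr _)
  | .inr _, .inl _, h => h.elim
  | .inr (.inl _), .inr (.inl _), h => h
  | .inr (.inl _), .inr (.inr _), h => congrArg inr h
  | .inr (.inr _), .inr (.inl _), h => h.elim
  | .inr (.inr _), .inr (.inr _), h => h

/-- The order of the children does not matter. -/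
def swapIso (a b t : PTree) :
    Vert (.cons a (.cons b t)) ≃o Vert (.cons b (.cons a t)) where
  toFun := swap
  invFun := swap
  left_inv := swap_swap
  right_inv := swap_swap
  map_rel_iff' := by
    intro v w
    refine ⟨fun h => ?_, swap_le v w⟩
    have := swap_le _ _ h
    rwa [Equiv.coe_fn_mk, swap_swap, swap_swap] at this

end Vert

/-- Two encoded trees are equivalent if they are isomorphic as posets. -/
instance PTree.setoid : Setoid PTree where
  r s t := Nonempty (Vert s ≃o Vert t)
  iseqv :=
    { refl := fun _ => ⟨OrderIso.refl _⟩
      symm := fun ⟨e⟩ => ⟨e.symm⟩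
      trans := fun ⟨e⟩ ⟨f⟩ => ⟨e.trans f⟩ }

/-- (Non-planar, finite) rooted trees, that is, isomorphism classes of rooted tree posets. -/
def RTree : Type := Quotient PTree.setoid

namespace RTree

/-- The class of an encoded tree. -/
def mk (t : PTree) : RTree := Quotient.mk _ t

/-- The rooted tree `•` with one vertex. -/
def bullet : RTree := mk .leaf

/-- Attach the tree `a` as one more child to the root of `t`. -/
def cons : RTree → RTree → RTree :=
  Quotient.map₂ PTree.cons fun _ _ ⟨e⟩ _ _ ⟨f⟩ => ⟨Vert.consIso e f⟩

instance : LeftCommutative cons where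
  left_comm := by
    rintro ⟨a⟩ ⟨b⟩ ⟨t⟩
    exact Quotient.sound ⟨Vert.swapIso a b t⟩

/-- `B₊` on forests: a new root with the given trees attached to it; `B₊(1) = •`. -/
def Bplus (u : Multiset RTree) : RTree := u.foldr cons bullet

/-- The number of vertices. -/
def size : RTree → ℕ :=
  Quotient.lift (fun t => Fintype.card (Vert t)) fun _ _ ⟨e⟩ => Fintype.card_congr e.toEquiv

/-- The order of the symmetry group `Sym(t)` of poset automorphisms. -/
def symCard : RTree → ℕ :=
  Quotient.lift (fun t => Nat.card (Vert t ≃o Vert t)) fun s t ⟨e⟩ => Nat.card_congr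
    { toFun := fun g => (e.symm.trans g).trans e
      invFun := fun g => (e.trans g).trans e.symm
      left_inv := fun g => by ext v; simp
      right_inv := fun g => by ext v; simp }

theorem card_cons (a t : PTree) :
    Fintype.card (Vert (.cons a t)) = Fintype.card (Vert a) + Fintype.card (Vert t) := by
  rw [← Fintype.card_congr (Vert.sumEquiv a t), Fintype.card_sum]

theorem card_pos (t : PTree) : 0 < Fintype.card (Vert t) := Fintype.card_pos_iff.2 ⟨⊤⟩

theorem finite_card_le (n : ℕ) : {t : PTree | Fintype.card (Vert t) ≤ n}.Finite := by
  induction n with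
  | zero =>
    refine Set.Finite.subset Set.finite_empty fun t ht => ?_
    have := card_pos t
    simp only [Set.mem_ofPred_eq] at ht
    omega
  | succ n ih =>
    refine ((ih.image2 PTree.cons ih).insert PTree.leaf).subset fun t ht => ?_
    cases t with
    | leaf => exact Set.mem_insert _ _
    | cons a t =>
      have h1 := card_pos a
      have h2 := card_pos t
      simp only [Set.mem_ofPred_eq, card_cons] at ht
      refine Set.mem_insert_of_mem _ ⟨a, ?_, t, ?_, rfl⟩ <;> simp only [Set.mem_ofPred_eq] <;> omega

theorem finite_size (n : ℕ) : {t : RTree | t.size = n}.Finite := by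
  refine ((finite_card_le n).image mk).subset ?_
  rintro ⟨t⟩ ht
  exact ⟨t, le_of_eq ht, rfl⟩

/-- The finite set of rooted trees with `n` vertices. -/
def ofSize (n : ℕ) : Finset RTree := (finite_size n).toFinset

end RTree

/-! ## The Grossman–Larson algebra -/

/-- The vector space with the rooted trees as a basis. -/
abbrev TreeSpace (k : Type*) [Field k] : Type _ := RTree →₀ k

/-- The list of the subtrees attached to the root of an encoded tree. -/
def PTree.children : PTree → List RTree
  | .leaf => []
  | .cons a t => RTree.mk a :: t.children

/-- The tree obtained from `t` by attaching to each vertex `v` all the trees in `g v`. -/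
def graft : (t : PTree) → (Vert t → Multiset RTree) → RTree
  | .leaf, g => RTree.Bplus (g .pt)
  | .cons a t, g => RTree.cons (graft a fun v => g (.inl v)) (graft t fun v => g (.inr v))

open Classical in
/-- The sum of the `m ^ n` trees obtained by attaching each of the `n` trees of the list `l` to some
one of the `m` vertices of `t`. -/
def attachSum (k : Type*) [Field k] (l : List RTree) (t : PTree) : TreeSpace k :=
  ∑ f : Fin l.length → Vert t,
    Finsupp.single (graft t fun v => (Finset.univ.filter fun i => f i = v).val.map l.get) 1

/-- The Grossman–Larson product `s ∘ t`: the sum of all the trees obtained by attaching each of the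
trees `s₁, …, sₙ`, where `s = B₊(s₁ ⋯ sₙ)`, to some vertex of `t`. It depends only on the
isomorphism classes `s` and `t`, and is computed here on representatives of them. -/
def glTree (k : Type*) [Field k] (s t : RTree) : TreeSpace k :=
  attachSum k (Quotient.out s).children (Quotient.out t)

/-- The Grossman–Larson product, extended bilinearly. -/
def gl (k : Type*) [Field k] : TreeSpace k →ₗ[k] TreeSpace k →ₗ[k] TreeSpace k :=
  Finsupp.lift _ k RTree fun s => Finsupp.lift _ k RTree fun t => glTree k s t

/-- The inner product with `(t, t) = |Sym(t)|` and `(t, t') = 0` for distinct trees `t`, `t'`. -/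
def treeInner (k : Type*) [Field k] : TreeSpace k →ₗ[k] TreeSpace k →ₗ[k] k :=
  Finsupp.lift _ k RTree fun t => (t.symCard : k) • Finsupp.lapply t

/-- `κₙ`, the sum of `t / |Sym(t)|` over the rooted trees `t` with `n + 1` vertices. -/
def kappa (k : Type*) [Field k] (n : ℕ) : TreeSpace k :=
  ∑ t ∈ RTree.ofSize (n + 1), Finsupp.single t ((t.symCard : k)⁻¹)

/-- `ε₀ = •` and `εₙ = κ₁ ∘ εₙ₋₁ - κ₂ ∘ εₙ₋₂ + ⋯ + (-1)ⁿ⁻¹ κₙ ∘ ε₀`. -/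
def epsilon (k : Type*) [Field k] : ℕ → TreeSpace k
  | 0 => Finsupp.single RTree.bullet 1
  | n + 1 => ∑ i : Fin (n + 1),
      (-1 : k) ^ (i : ℕ) • gl k (kappa k (i + 1)) (epsilon k (n - i))
  termination_by n => n
  decreasing_by omega

/-! ## The Connes–Kreimer algebra -/

/-- The Connes–Kreimer algebra: the free commutative algebra on the rooted trees. -/
abbrev HK (k : Type*) [Field k] : Type _ := MvPolynomial RTree k

/-- A forest, as a monomial in the Connes–Kreimer algebra. -/
def forest (k : Type*) [Field k] (u : Multiset RTree) : HK k := (u.map MvPolynomial.X).prod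

/-- The linear map `B₊` from the Connes–Kreimer algebra to the space of trees. -/
def BplusTree (k : Type*) [Field k] : HK k →ₗ[k] TreeSpace k :=
  (MvPolynomial.basisMonomials RTree k).constr k fun d =>
    Finsupp.single (RTree.Bplus (Finsupp.toMultiset d)) 1

/-- The linear operator `B₊` on the Connes–Kreimer algebra. -/
def Bplus (k : Type*) [Field k] : HK k →ₗ[k] HK k :=
  (MvPolynomial.basisMonomials RTree k).constr k fun d =>
    MvPolynomial.X (RTree.Bplus (Finsupp.toMultiset d))

/-- The duality pairing `⟨t, u⟩ = (t, B₊(u))` of the Grossman–Larson and the Connes–Kreimer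
algebras. -/
def pairTree (k : Type*) [Field k] (t : TreeSpace k) (u : HK k) : k :=
  treeInner k t (BplusTree k u)

/-! ## Quasi-symmetric functions -/

/-- A composition: a finite sequence of positive integers. -/
abbrev Comp : Type := List ℕ+

/-- The sequence of parts of a composition, as exponents. -/
def Comp.exponents (I : Comp) : Fin I.length →₀ ℕ :=
  Finsupp.equivFunOnFinite.symm fun j => (I.get j : ℕ)

/-- The exponent of the monomial `x_{n₁}^{i₁} ⋯ x_{nₗ}^{iₗ}` for strictly increasing
`n₁ < ⋯ < nₗ`. The variables are numbered from `0`. -/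
def expAt {l : ℕ} (d : Fin l →₀ ℕ) (n : Fin l ↪o ℕ) : ℕ →₀ ℕ := d.embDomain n.toEmbedding

/-- The algebra of quasi-symmetric functions: power series of bounded degree in which the
coefficients of `x_{n₁}^{i₁} ⋯ x_{nₗ}^{iₗ}` and `x_{n'₁}^{i₁} ⋯ x_{n'ₗ}^{iₗ}` agree for
all `n₁ < ⋯ < nₗ` and `n'₁ < ⋯ < n'ₗ`. -/
def QSym (k : Type*) [Field k] : Subalgebra k (MvPowerSeries ℕ k) where
  carrier := {f | (∃ N : ℕ, ∀ d, MvPowerSeries.coeff d f ≠ 0 → d.degree ≤ N) ∧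
    ∀ (l : ℕ) (d : Fin l →₀ ℕ) (n n' : Fin l ↪o ℕ),
      MvPowerSeries.coeff (expAt d n) f = MvPowerSeries.coeff (expAt d n') f}
  mul_mem' := by
    rintro f g ⟨⟨N, hN⟩, hf⟩ ⟨⟨M, hM⟩, hg⟩
    refine ⟨⟨N + M, fun d hd => ?_⟩, fun l d n n' => ?_⟩
    · rw [MvPowerSeries.coeff_mul] at hd
      obtain ⟨p, hp, hne⟩ := Finset.exists_ne_zero_of_sum_ne_zero hd
      rw [← Finset.HasAntidiagonal.mem_antidiagonal.1 hp, map_add]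
      exact add_le_add (hN _ (left_ne_zero_of_mul hne)) (hM _ (right_ne_zero_of_mul hne))
    · have key : ∀ h : MvPowerSeries ℕ k, (∀ (l : ℕ) (d : Fin l →₀ ℕ) (n n' : Fin l ↪o ℕ),
          MvPowerSeries.coeff (expAt d n) h = MvPowerSeries.coeff (expAt d n') h) →
          MvPowerSeries.killCompl n.toEmbedding h = MvPowerSeries.killCompl n'.toEmbedding h :=
        fun h hh => by
          ext e
          exact hh l e n n'
      change MvPowerSeries.coeff d (MvPowerSeries.killCompl n.toEmbedding (f * g)) =
        MvPowerSeries.coeff d (MvPowerSeries.killCompl n'.toEmbedding (f * g))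
      rw [map_mul (MvPowerSeries.killCompl n.toEmbedding),
        map_mul (MvPowerSeries.killCompl n'.toEmbedding), key f hf, key g hg]
  add_mem' := by
    rintro f g ⟨⟨N, hN⟩, hf⟩ ⟨⟨M, hM⟩, hg⟩
    refine ⟨⟨max N M, fun d hd => ?_⟩, fun l d n n' => ?_⟩
    · by_cases h : MvPowerSeries.coeff d f = 0
      · rw [map_add, h, zero_add] at hd
        exact (hM d hd).trans (le_max_right _ _)
      · exact (hN d h).trans (le_max_left _ _)
    · rw [map_add, map_add, hf l d n n', hg l d n n']
  algebraMap_mem' r := by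
    refine ⟨⟨0, fun d hd => ?_⟩, fun l d n n' => ?_⟩
    · classical
      rw [MvPowerSeries.algebraMap_apply, MvPowerSeries.coeff_C] at hd
      simp only [ne_eq, ite_eq_right_iff, Classical.not_imp] at hd
      simp [hd.1]
    · change MvPowerSeries.coeff d (MvPowerSeries.killCompl n.toEmbedding (algebraMap k _ r)) =
        MvPowerSeries.coeff d (MvPowerSeries.killCompl n'.toEmbedding (algebraMap k _ r))
      rw [AlgHom.commutes, AlgHom.commutes]

open Classical in
/-- The power series `M_I`, the sum of `x_{n₁}^{i₁} ⋯ x_{nₗ}^{iₗ}` over `n₁ < ⋯ < nₗ`. -/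
def monomialSeries (k : Type*) [Field k] (I : Comp) : MvPowerSeries ℕ k :=
  fun d => if ∃ n : Fin I.length ↪o ℕ, d = expAt I.exponents n then 1 else 0

open Classical in
theorem coeff_monomialSeries (k : Type*) [Field k] (I : Comp) (d : ℕ →₀ ℕ) :
    MvPowerSeries.coeff d (monomialSeries k I) =
      if ∃ n : Fin I.length ↪o ℕ, d = expAt I.exponents n then 1 else 0 := rfl

theorem expAt_apply {l : ℕ} (d : Fin l →₀ ℕ) (n : Fin l ↪o ℕ) (j : Fin l) :
    expAt d n (n j) = d j := Finsupp.embDomain_apply_self n.toEmbedding d j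

theorem degree_expAt {l : ℕ} (d : Fin l →₀ ℕ) (n : Fin l ↪o ℕ) :
    (expAt d n).degree = d.degree := by
  rw [Finsupp.degree_apply, Finsupp.degree_apply, expAt, Finsupp.support_embDomain, Finset.sum_map]
  exact Finset.sum_congr rfl fun j _ => expAt_apply d n j

/-- The degree `|I| = i₁ + ⋯ + iₗ` of a composition. -/
def Comp.weight (I : Comp) : ℕ := (I.map fun i : ℕ+ => (i : ℕ)).sum

theorem degree_exponents (I : Comp) : I.exponents.degree = I.weight := by
  rw [Finsupp.degree_eq_sum, Comp.weight]
  simp only [Comp.exponents, Finsupp.equivFunOnFinite_symm_apply_apply]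
  rw [← List.sum_ofFn]
  congr 1
  apply List.ext_get <;> simp

theorem exponents_ne_zero (I : Comp) (j : Fin I.length) : I.exponents j ≠ 0 := by
  simp [Comp.exponents]

theorem support_expAt (I : Comp) (n : Fin I.length ↪o ℕ) :
    (expAt I.exponents n).support = Finset.univ.map n.toEmbedding := by
  rw [expAt, Finsupp.support_embDomain]
  congr 1
  ext j
  simp [exponents_ne_zero]

theorem eq_of_expAt_eq {I J : Comp} {n : Fin I.length ↪o ℕ} {m : Fin J.length ↪o ℕ}
    (h : expAt I.exponents n = expAt J.exponents m) : I = J := by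
  have key : ∀ (l l' : ℕ) (n : Fin l ↪o ℕ) (m : Fin l' ↪o ℕ), l = l' →
      Finset.univ.map n.toEmbedding = Finset.univ.map m.toEmbedding →
      ∀ (i : ℕ) (hi : i < l) (hi' : i < l'), n ⟨i, hi⟩ = m ⟨i, hi'⟩ := by
    rintro l l' n m rfl hnm i hi _
    have hr : Set.range n = Set.range m := by
      have := congrArg (fun s : Finset ℕ => (s : Set ℕ)) hnm
      simpa using this
    exact congrFun ((StrictMono.range_inj n.strictMono m.strictMono).1 hr) _
  have hs : Finset.univ.map n.toEmbedding = Finset.univ.map m.toEmbedding := by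
    rw [← support_expAt, ← support_expAt, h]
  have hl : I.length = J.length := by
    have := congrArg Finset.card hs
    simpa using this
  refine List.ext_get hl fun i hi hi' => ?_
  have h1 := expAt_apply I.exponents n ⟨i, hi⟩
  have h2 := expAt_apply J.exponents m ⟨i, hi'⟩
  rw [h, key _ _ n m hl hs i hi hi', h2] at h1
  exact PNat.coe_injective h1.symm

theorem exists_expAt (d : ℕ →₀ ℕ) :
    ∃ (I : Comp) (n : Fin I.length ↪o ℕ), d = expAt I.exponents n := by
  classical
  let o := d.support.orderEmbOfFin rfl
  have ho : ∀ j, d (o j) ≠ 0 := fun j =>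
    Finsupp.mem_support_iff.1 (Finset.orderEmbOfFin_mem d.support rfl j)
  let a : Fin d.support.card → ℕ+ := fun j => Nat.toPNat (d (o j)) (Nat.pos_of_ne_zero (ho j))
  let I : Comp := List.ofFn a
  have hI : I.length = d.support.card := List.length_ofFn
  let n : Fin I.length ↪o ℕ := (Fin.castOrderIso hI).toOrderEmbedding.trans o
  have hn : ∀ j, expAt I.exponents n (n j) = d (n j) := fun j => by
    rw [expAt_apply]
    change (((List.ofFn a).get j : ℕ+) : ℕ) = _
    rw [List.get_ofFn]
    rfl
  refine ⟨I, n, Finsupp.ext fun x => ?_⟩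
  by_cases hx : x ∈ d.support
  · obtain ⟨j, rfl⟩ : ∃ j, o j = x := by
      have : x ∈ Set.range o := by
        rw [Finset.range_orderEmbOfFin]
        exact hx
      exact this
    exact (hn ((Fin.castOrderIso hI).symm j)).symm
  · rw [Finsupp.notMem_support_iff.1 hx]
    refine (Finsupp.embDomain_of_notMem_range _ _ _ ?_).symm
    rintro ⟨j, rfl⟩
    exact hx (Finset.orderEmbOfFin_mem d.support rfl _)

theorem coeff_monomialSeries_expAt (k : Type*) [Field k] (I J : Comp) (n : Fin J.length ↪o ℕ) :
    MvPowerSeries.coeff (expAt J.exponents n) (monomialSeries k I) = if J = I then 1 else 0 := by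
  classical
  rw [coeff_monomialSeries]
  refine if_congr ⟨fun ⟨_, h⟩ => eq_of_expAt_eq h, ?_⟩ rfl rfl
  rintro rfl
  exact ⟨n, rfl⟩

theorem monomialSeries_mem (k : Type*) [Field k] (I : Comp) : monomialSeries k I ∈ QSym k := by
  classical
  refine ⟨⟨I.weight, fun d hd => ?_⟩, fun l d n n' => ?_⟩
  · rw [coeff_monomialSeries] at hd
    simp only [ne_eq, ite_eq_right_iff, Classical.not_imp] at hd
    obtain ⟨⟨n, rfl⟩, -⟩ := hd
    rw [degree_expAt, degree_exponents]
  · have key : ∀ n n' : Fin l ↪o ℕ, (∃ m : Fin I.length ↪o ℕ, expAt d n = expAt I.exponents m) →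
        ∃ m : Fin I.length ↪o ℕ, expAt d n' = expAt I.exponents m := by
      rintro n n' ⟨m, hm⟩
      have hr : ∀ j, ∃ i, n i = m j := fun j => by
        have h1 : expAt d n (m j) ≠ 0 := by
          rw [hm, expAt_apply]
          exact exponents_ne_zero I j
        by_contra hc
        exact h1 (Finsupp.embDomain_of_notMem_range _ _ _ hc)
      choose p hp using hr
      let q : Fin I.length ↪o Fin l := OrderEmbedding.ofStrictMono p fun a b hab => by
        rw [← n.lt_iff_lt, hp, hp]
        exact m.strictMono hab
      have hq : ∀ j, q j = p j := fun _ => rfl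
      have hd : d = Finsupp.embDomain q.toEmbedding I.exponents := by
        apply Finsupp.embDomain_injective n.toEmbedding
        have e1 : q.toEmbedding.trans n.toEmbedding = m.toEmbedding :=
          Function.Embedding.ext hp
        rw [← Finsupp.embDomain_trans_apply, e1]
        exact hm
      refine ⟨q.trans n', ?_⟩
      rw [hd, expAt, ← Finsupp.embDomain_trans_apply]
      rfl
    rw [coeff_monomialSeries, coeff_monomialSeries]
    exact if_congr ⟨key n n', key n' n⟩ rfl rfl

/-- The monomial quasi-symmetric function `M_I`. -/
def QSym.M (k : Type*) [Field k] (I : Comp) : QSym k := ⟨monomialSeries k I, monomialSeries_mem k I⟩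

theorem finite_weight_le (N : ℕ) : {I : Comp | I.weight ≤ N}.Finite := by
  induction N with
  | zero =>
    refine (Set.finite_singleton ([] : Comp)).subset fun I hI => ?_
    cases I with
    | nil => rfl
    | cons a I =>
      have := a.pos
      simp only [Set.mem_ofPred_eq, Comp.weight, List.map_cons, List.sum_cons] at hI
      omega
  | succ N ih =>
    have hf : {a : ℕ+ | (a : ℕ) ≤ N + 1}.Finite :=
      (Set.finite_Iic (N + 1)).preimage PNat.coe_injective.injOn
    refine ((hf.image2 List.cons ih).insert []).subset fun I hI => ?_
    cases I with
    | nil => exact Set.mem_insert _ _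
    | cons a I =>
      have := a.pos
      simp only [Set.mem_ofPred_eq, Comp.weight, List.map_cons, List.sum_cons] at hI
      refine Set.mem_insert_of_mem _ ⟨a, ?_, I, ?_, rfl⟩ <;>
        simp only [Set.mem_ofPred_eq, Comp.weight] <;> omega

/-- The finite set of compositions of `n`. -/
def Comp.ofWeight (n : ℕ) : Finset Comp :=
  ((finite_weight_le n).subset fun I (hI : I.weight = n) => le_of_eq hI).toFinset

/-- The coefficient of `M_I` in a quasi-symmetric function, read off at `x₁^{i₁} ⋯ xₗ^{iₗ}`. -/
def QSym.coeffM (k : Type*) [Field k] (I : Comp) : QSym k →ₗ[k] k :=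
  (MvPowerSeries.coeff (expAt I.exponents (Fin.valOrderEmb _))).comp (QSym k).val.toLinearMap

theorem QSym.coeffM_M (k : Type*) [Field k] (I J : Comp) :
    QSym.coeffM k I (QSym.M k J) = if I = J then 1 else 0 :=
  coeff_monomialSeries_expAt k J I _

theorem QSym.ext_coeffM {k : Type*} [Field k] {f g : QSym k}
    (h : ∀ I, QSym.coeffM k I f = QSym.coeffM k I g) : f = g := by
  apply Subtype.ext
  ext d
  obtain ⟨I, n, rfl⟩ := exists_expAt d
  rw [f.2.2 _ _ n (Fin.valOrderEmb _), g.2.2 _ _ n (Fin.valOrderEmb _)]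
  exact h I

theorem QSym.finite_coeffM {k : Type*} [Field k] (f : QSym k) :
    {I | QSym.coeffM k I f ≠ 0}.Finite := by
  obtain ⟨N, hN⟩ := f.2.1
  refine (finite_weight_le N).subset fun I hI => ?_
  have := hN _ hI
  rwa [degree_expAt, degree_exponents] at this

/-- The `M_I` are a basis of the algebra of quasi-symmetric functions. -/
def QSym.basis (k : Type*) [Field k] : Module.Basis Comp k (QSym k) :=
  Module.Basis.mk (v := QSym.M k)
    (by
      rw [linearIndependent_iff]
      intro c hc
      ext I
      have := congrArg (QSym.coeffM k I) hc
      rw [Finsupp.linearCombination_apply, Finsupp.sum, map_sum] at this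
      simpa [QSym.coeffM_M] using this)
    (by
      intro f _
      have hf : f = ∑ I ∈ (QSym.finite_coeffM f).toFinset, QSym.coeffM k I f • QSym.M k I := by
        apply QSym.ext_coeffM
        intro J
        rw [map_sum]
        simp [QSym.coeffM_M]
      rw [hf]
      exact Submodule.sum_mem _ fun I _ =>
        Submodule.smul_mem _ _ (Submodule.subset_span ⟨I, rfl⟩))

theorem QSym.basis_apply (k : Type*) [Field k] (I : Comp) : QSym.basis k I = QSym.M k I := by
  simp [QSym.basis]

/-- The linear map `α₊` with `α₊(M_I) = M_{I ⊔ (1)}`. -/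
def alphaPlus (k : Type*) [Field k] : QSym k →ₗ[k] QSym k :=
  (QSym.basis k).constr k fun I => QSym.M k (I ++ [1])

/-! ## Noncommutative symmetric functions and Zhao's homomorphism -/

/-- The algebra of noncommutative symmetric functions, free on `E₁, E₂, …`. -/
abbrev NSym (k : Type*) [Field k] : Type _ := FreeAlgebra k ℕ+

/-- `E_I = E_{i₁} ⋯ E_{iₗ}`. -/
def NSym.E (k : Type*) [Field k] (I : Comp) : NSym k := (I.map (FreeAlgebra.ι k)).prod

/-- The pairing of noncommutative symmetric and quasi-symmetric functions that is determined by
`⟨E_I, M_J⟩ = δ_{I, J}`. -/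
def pairNQ (k : Type*) [Field k] (P : NSym k) (f : QSym k) : k :=
  (FreeAlgebra.basisFreeMonoid k ℕ+).constr k
    (fun w => (QSym.basis k).repr f (FreeMonoid.toList w)) P

/-- Zhao's homomorphism `Z` from the noncommutative symmetric functions to the Grossman–Larson
algebra, with `Z(Eₙ) = εₙ`: a noncommutative polynomial `P` goes to the value on the unit `•` of
`P` evaluated at the left multiplications by the `εₙ`. -/
def Z (k : Type*) [Field k] : NSym k →ₗ[k] TreeSpace k :=
  (LinearMap.applyₗ (Finsupp.single RTree.bullet 1 : TreeSpace k)).comp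
    (FreeAlgebra.lift k fun n : ℕ+ => (gl k (epsilon k n) : Module.End k (TreeSpace k))).toLinearMap

/-- The dual `Z^*` of `Z`: it sends a forest `u` with `n` vertices to the sum of `⟨Z(E_I), u⟩ M_I`
over the compositions `I` of `n`. -/
def Zstar (k : Type*) [Field k] : HK k →ₗ[k] QSym k :=
  (MvPolynomial.basisMonomials RTree k).constr k fun d =>
    ∑ I ∈ Comp.ofWeight ((Finsupp.toMultiset d).map RTree.size).sum,
      pairTree k (Z k (NSym.E k I)) (MvPolynomial.monomial d 1) • QSym.M k I

end ConnesKreimer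

end

/-! Every tree is `B₊` of a unique forest, so a homomorphism `ρ` from `HK` with `ρ ∘ B₊ = L ∘ ρ` is
forced, recursively, to send a tree `t` to `L` of the product of its values on the children of `t`.
This gives uniqueness. Existence holds because the recursion does not see the order of the children,
and so descends from encodings to isomorphism classes (`PTree.eq_of_iso`, `initialHom`). This is
(3); everything else follows once `Zstar` is identified with `toQSym`, the initial homomorphism for
`L = α₊` (`Zstar_eq_toQSym`). In particular multiplicativity of `Zstar` is never proved directly.

The identification says that the `M_I`-coefficient of `toQSym x` is `⟨Z(E_I), x⟩`, and goes by
induction on `I`, removing the first part `n`. On the quasi-symmetric side this means taking the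
coefficient of `yⁿ` in `f(y, x₀, x₁, …)`, where `f ↦ f(y, x₀, …)` is an algebra homomorphism
(`QSym.separate`). On the tree side `Z(E_{n,I}) = εₙ ∘ Z(E_I)`. The two match because of three
facts.

Duality (`pairL_gl`): `⟨S ∘ T, x⟩ = ⟨S ⊗ T, Δ x⟩`, where `Δ` is the homomorphism with `Δ B₊(u) =
B₊(u) ⊗ 1 + (id ⊗ B₊) Δ(u)`, itself obtained from the universal property. The proof rests on an
adjunction: adding a child `a` to the root is adjoint to the derivation `b ↦ (a, b)` of `HK`, which
is the recursion for `|Sym|` in another form.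

The functionals `εₙ` (`pairL_epsilon`): `∑ ⟨εₙ, ·⟩ yⁿ` is the character with `• ↦ y` and all other
trees `↦ 0`. Indeed `∑ (-1)ⁿ ⟨κₙ, ·⟩ yⁿ` is the character `t ↦ (-y)^|t|`, the convolution of the two
characters is the counit, and the recursion defining `εₙ` expresses exactly this.

Separation (`separate_toQSym`): `toQSym` followed by `y`-separation equals `(ε ⊗ toQSym) ∘ Δ`. Both
are homomorphisms, so it suffices to compare them along `B₊`. -/

noncomputable section
namespace ConnesKreimer

/-! ### Isomorphisms of encoded trees, one child at a time -/

/-- The children of the root of an encoded tree. -/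
def PTree.Child : PTree → Type
  | .leaf => Empty
  | .cons _ t => Option t.Child

namespace PTree

instance Child.fintype : (t : PTree) → Fintype t.Child
  | .leaf => inferInstanceAs (Fintype Empty)
  | .cons _ t =>
      letI := Child.fintype t
      inferInstanceAs (Fintype (Option t.Child))

/-- The subtree at a child of the root. -/
def sub : {t : PTree} → t.Child → PTree
  | .leaf, c => c.elim
  | .cons a _, none => a
  | .cons _ _, some c => sub c

/-- The tree that remains after removing the subtree at a child of the root. -/
def del : {t : PTree} → t.Child → PTree
  | .leaf, c => c.elim
  | .cons _ t, none => t
  | .cons a _, some c => .cons a (del c)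

/-- A tree is isomorphic to the tree with one child moved to the front. -/
def moveFront : {t : PTree} → (c : t.Child) → Vert (.cons (sub c) (del c)) ≃o Vert t
  | .leaf, c => c.elim
  | .cons _ _, none => OrderIso.refl _
  | .cons a _, some c =>
      (Vert.swapIso (sub c) a (del c)).trans (Vert.consIso (OrderIso.refl _) (moveFront c))

theorem children_eq_cons : {t : PTree} → (c : t.Child) →
    (t.children : Multiset RTree) = RTree.mk (sub c) ::ₘ ((del c).children : Multiset RTree)
  | .leaf, c => c.elim
  | .cons _ _, none => rfl
  | .cons a t, some c => by
      have h := children_eq_cons c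
      change RTree.mk a ::ₘ (t.children : Multiset RTree) =
        RTree.mk (sub c) ::ₘ (RTree.mk a ::ₘ ((del c).children : Multiset RTree))
      rw [h, Multiset.cons_swap]

theorem exists_moveFront_inl : {t : PTree} → (v : Vert t) → v ≠ ⊤ →
    ∃ (c : t.Child) (w : Vert (sub c)), moveFront c (.inl w) = v
  | .leaf, .pt, h => (h rfl).elim
  | .cons _ _, .inl v, _ => ⟨none, v, rfl⟩
  | .cons _ _, .inr v, h => by
      obtain ⟨c, w, hw⟩ := exists_moveFront_inl v fun h' => h (congrArg Vert.inr h')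
      exact ⟨some c, w, congrArg Vert.inr hw⟩

theorem moveFront_inl_inj : {t : PTree} → (c c' : t.Child) → (v : Vert (sub c)) →
    (v' : Vert (sub c')) → moveFront c (.inl v) = moveFront c' (.inl v') → c = c'
  | .leaf, c, _, _, _, _ => c.elim
  | .cons _ _, none, none, _, _, _ => rfl
  | .cons _ _, none, some _, _, _, h => nomatch (h : Vert.inl _ = Vert.inr _)
  | .cons _ _, some _, none, _, _, h => nomatch (h : Vert.inr _ = Vert.inl _)
  | .cons _ _, some c, some c', v, v', h =>
      congrArg some (moveFront_inl_inj c c' v v' (Vert.inr.inj (h : Vert.inr _ = Vert.inr _)))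

end PTree

namespace Vert

theorem inl_ne_top {a t : PTree} (v : Vert a) : (inl v : Vert (.cons a t)) ≠ ⊤ := nofun

theorem inr_injective {a t : PTree} : Function.Injective (inr : Vert t → Vert (.cons a t)) :=
  fun _ _ => Vert.inr.inj

theorem inl_injective {a t : PTree} : Function.Injective (inl : Vert a → Vert (.cons a t)) :=
  fun _ _ => Vert.inl.inj

theorem eq_inl_or_eq_inr {a t : PTree} : ∀ v : Vert (.cons a t), (∃ w, v = inl w) ∨ ∃ w, v = inr w
  | .inl w => Or.inl ⟨w, rfl⟩
  | .inr w => Or.inr ⟨w, rfl⟩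

/-- This describes the first subtree by the order alone, as the down-set of its root, so that
isomorphisms transport it. -/
theorem le_inl_top_iff {a t : PTree} (v : Vert (.cons a t)) :
    v ≤ inl ⊤ ↔ ∃ w, v = inl w := by
  constructor
  · intro h
    match v, h with
    | .inl w, _ => exact ⟨w, rfl⟩
    | .inr _, h => exact h.elim
  · rintro ⟨w, rfl⟩
    exact inl_le_inl.2 le_top

theorem eq_of_inl_top_le {a t : PTree} (v : Vert (.cons a t)) (h : inl ⊤ ≤ v) :
    v = inl ⊤ ∨ v = ⊤ := by
  match v, h with
  | .inl w, h => exact Or.inl (congrArg inl (top_le_iff.1 (inl_le_inl.1 h)))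
  | .inr w, h => exact Or.inr (congrArg inr (inl_le_inr.1 h))

/-- An isomorphism that maps the first child to the first child is assembled from
isomorphisms of the parts. -/
theorem exists_eq_consIso {a t a' t' : PTree} (e : Vert (.cons a t) ≃o Vert (.cons a' t'))
    (he : e (inl ⊤) = inl ⊤) :
    ∃ (f : Vert a ≃o Vert a') (g : Vert t ≃o Vert t'), consIso f g = e := by
  have hl : ∀ v, ∃ w, e (inl v) = inl w := fun v => by
    rw [← le_inl_top_iff, ← he, e.le_iff_le, le_inl_top_iff]
    exact ⟨v, rfl⟩
  have hl' : ∀ w, ∃ v, e (inl v) = inl w := fun w => by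
    obtain ⟨v, hv⟩ := e.surjective (inl w)
    have : v ≤ inl ⊤ := by
      rw [← e.le_iff_le, he, hv, le_inl_top_iff]
      exact ⟨w, rfl⟩
    obtain ⟨v', rfl⟩ := (le_inl_top_iff v).1 this
    exact ⟨v', hv⟩
  -- Since `e` maps the first subtree onto the first subtree, it also maps the complement to the
  -- complement.
  have hr : ∀ v, ∃ w, e (inr v) = inr w := fun v => by
    obtain ⟨w, h⟩ | ⟨w, h⟩ := eq_inl_or_eq_inr (e (inr v))
    · obtain ⟨v', hv'⟩ := hl' w
      exact nomatch e.injective (hv'.trans h.symm)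
    · exact ⟨w, h⟩
  have hr' : ∀ w, ∃ v, e (inr v) = inr w := fun w => by
    obtain ⟨v, hv⟩ := e.surjective (inr w)
    obtain ⟨v, rfl⟩ | ⟨v, rfl⟩ := eq_inl_or_eq_inr v
    · obtain ⟨w', hw'⟩ := hl v
      exact nomatch hw'.symm.trans hv
    · exact ⟨v, hv⟩
  choose f hf using hl
  choose g hg using hr
  have hfb : Function.Bijective f :=
    ⟨fun x y h => inl_injective (e.injective (by rw [hf, hf, h])), fun w => by
      obtain ⟨v, hv⟩ := hl' w
      exact ⟨v, inl_injective ((hf v).symm.trans hv)⟩⟩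
  have hgb : Function.Bijective g :=
    ⟨fun x y h => inr_injective (e.injective (by rw [hg, hg, h])), fun w => by
      obtain ⟨v, hv⟩ := hr' w
      exact ⟨v, inr_injective ((hg v).symm.trans hv)⟩⟩
  refine ⟨⟨Equiv.ofBijective f hfb, fun {x y} => ?_⟩,
    ⟨Equiv.ofBijective g hgb, fun {x y} => ?_⟩, ?_⟩
  · change f x ≤ f y ↔ x ≤ y
    rw [← inl_le_inl (t := t'), ← hf, ← hf, e.le_iff_le, inl_le_inl]
  · change g x ≤ g y ↔ x ≤ y
    rw [← inr_le_inr (a := a'), ← hg, ← hg, e.le_iff_le, inr_le_inr]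
  · refine OrderIso.ext (funext fun v => ?_)
    obtain ⟨v, rfl⟩ | ⟨v, rfl⟩ := eq_inl_or_eq_inr v
    · exact (hf v).symm
    · exact (hg v).symm

/-- Isomorphisms from `cons a t` to `s` correspond to a choice of a child of `s` and isomorphisms
of the parts. -/
def isoOfChild {a t s : PTree} :
    (Σ c : s.Child, (Vert a ≃o Vert (PTree.sub c)) × (Vert t ≃o Vert (PTree.del c))) →
      (Vert (.cons a t) ≃o Vert s) :=
  fun x => (consIso x.2.1 x.2.2).trans (PTree.moveFront x.1)

/-- An isomorphism takes the root of `a` to the root of the subtree at some child `c` of `s`. That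
child is determined by the isomorphism, and after moving `c` to the front the isomorphism splits
into its two parts. Surjectivity drives the inductions over isomorphic trees; bijectivity counts
automorphisms. -/
theorem isoOfChild_bijective {a t s : PTree} :
    Function.Bijective (isoOfChild (a := a) (t := t) (s := s)) := by
  constructor
  · rintro ⟨c, e, f⟩ ⟨c', e', f'⟩ h
    have h1 : ∀ v, PTree.moveFront c (consIso e f v) = PTree.moveFront c' (consIso e' f' v) :=
      fun v => DFunLike.congr_fun h v
    obtain rfl : c = c' := PTree.moveFront_inl_inj c c' _ _ (h1 (.inl ⊤))
    have h2 : ∀ v, consIso e f v = consIso e' f' v :=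
      fun v => (PTree.moveFront c).injective (h1 v)
    have h3 : e = e' := OrderIso.ext (funext fun v => inl_injective (h2 (.inl v)))
    have h4 : f = f' := OrderIso.ext (funext fun v => inr_injective (h2 (.inr v)))
    rw [h3, h4]
  · intro e
    obtain ⟨c, w, hw⟩ := PTree.exists_moveFront_inl (e (.inl ⊤)) fun h =>
      inl_ne_top _ (e.injective (h.trans (map_top e).symm))
    let e' := e.trans (PTree.moveFront c).symm
    have he : e' (.inl ⊤) = .inl w := by
      simp [e', ← hw]
    -- The preimage of the root of the subtree at `c` lies above the root of `a`, hence is that root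
    -- or the root of the whole tree; the latter is excluded because isomorphisms fix the top.
    have he' : e' (.inl ⊤) = .inl ⊤ := by
      have h1 : inl ⊤ ≤ e'.symm (.inl ⊤) := by
        rw [← e'.le_iff_le, e'.apply_symm_apply, he]
        exact inl_le_inl.2 le_top
      rcases eq_of_inl_top_le _ h1 with h2 | h2
      · rw [← h2, e'.apply_symm_apply]
      · rw [← map_top e'.symm] at h2
        exact (inl_ne_top _ (e'.symm.injective h2)).elim
    obtain ⟨f, g, hfg⟩ := exists_eq_consIso e' he'
    refine ⟨⟨c, f, g⟩, ?_⟩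
    rw [isoOfChild, hfg]
    ext v
    simp [e']

end Vert

namespace PTree

theorem exists_child_of_iso {a t s : PTree} (e : Vert (.cons a t) ≃o Vert s) :
    ∃ c : s.Child, Nonempty (Vert a ≃o Vert (sub c)) ∧ Nonempty (Vert t ≃o Vert (del c)) := by
  obtain ⟨⟨c, f, g⟩, -⟩ := Vert.isoOfChild_bijective.2 e
  exact ⟨c, ⟨f⟩, ⟨g⟩⟩

theorem eq_leaf_of_iso {s : PTree} (e : Vert .leaf ≃o Vert s) : s = .leaf := by
  cases s with
  | leaf => rfl
  | cons a t =>
    have := e.symm.injective (a₁ := .inl ⊤) (a₂ := ⊤) (Subsingleton.elim (h := ⟨by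
      rintro ⟨⟩ ⟨⟩
      rfl⟩) _ _)
    exact (Vert.inl_ne_top _ this).elim

/-- A function on encoded trees, given by a recursion that does not depend on the order of the
children, is invariant under isomorphism. -/
theorem eq_of_iso {A : Type*} [CommMonoid A] (p : PTree → A) (F : A → A)
    (hp : ∀ a t, p (.cons a t) = F (p a) * p t) :
    ∀ {t s : PTree}, (Vert t ≃o Vert s) → p t = p s := by
  -- By commutativity the recursion may split off any child, not only the first.
  have hc : ∀ (s : PTree) (c : s.Child), p s = F (p (sub c)) * p (del c) := by
    intro s
    induction s with
    | leaf => exact fun c => c.elim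
    | cons a t _ ih =>
      rintro (_ | c)
      · exact hp a t
      · change p (.cons a t) = F (p (sub c)) * p (.cons a (del c))
        rw [hp, hp, ih c, mul_left_comm]
  intro t
  induction t with
  | leaf => intro s e; rw [eq_leaf_of_iso e]
  | cons a t iha iht =>
    intro s e
    obtain ⟨c, ⟨f⟩, ⟨g⟩⟩ := exists_child_of_iso e
    rw [hp, hc s c, iha f, iht g]

theorem children_eq_of_iso {t s : PTree} (e : Vert t ≃o Vert s) :
    (t.children : Multiset RTree) = s.children := by
  induction t generalizing s with
  | leaf => rw [eq_leaf_of_iso e]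
  | cons a t _ iht =>
    obtain ⟨c, ⟨f⟩, ⟨g⟩⟩ := exists_child_of_iso e
    have h : RTree.mk a = RTree.mk (sub c) := Quotient.sound ⟨f⟩
    rw [children_eq_cons c, ← iht g, ← h]
    rfl

end PTree

/-! ### Trees as forests of their children, and the orders of symmetry groups -/

namespace RTree

/-- The forest of the subtrees attached to the root. -/
def children : RTree → Multiset RTree :=
  Quotient.lift (fun t => (t.children : Multiset RTree)) fun _ _ ⟨e⟩ => PTree.children_eq_of_iso e

theorem Bplus_zero : Bplus 0 = bullet := rfl

theorem Bplus_cons (a : RTree) (u : Multiset RTree) : Bplus (a ::ₘ u) = cons a (Bplus u) :=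
  Multiset.foldr_cons _ _ _ _

theorem children_cons (a t : RTree) : (cons a t).children = a ::ₘ t.children := by
  induction a using Quotient.ind
  induction t using Quotient.ind
  rfl

theorem children_Bplus (u : Multiset RTree) : (Bplus u).children = u := by
  induction u using Multiset.induction with
  | empty => rfl
  | cons a u ih => rw [Bplus_cons, children_cons, ih]

theorem Bplus_injective : Function.Injective Bplus :=
  Function.LeftInverse.injective children_Bplus

/-- Together with `children_Bplus`, this makes `B₊` a bijection from forests to trees. -/
theorem Bplus_children (t : RTree) : Bplus t.children = t := by
  induction t using Quotient.ind with
  | _ t =>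
    change Bplus (t.children : Multiset RTree) = mk t
    induction t with
    | leaf => rfl
    | cons a t _ ih =>
      change Bplus (mk a ::ₘ (t.children : Multiset RTree)) = _
      rw [Bplus_cons, ih]
      rfl

theorem cons_children (a t : RTree) : cons a t = Bplus (a ::ₘ t.children) := by
  rw [Bplus_cons, Bplus_children]

@[elab_as_elim]
theorem Bplus_induction {motive : RTree → Prop}
    (h : ∀ u : Multiset RTree, (∀ t ∈ u, motive t) → motive (Bplus u)) (t : RTree) :
    motive t := by
  induction t using Quotient.ind with
  | _ t =>
    -- Recursion on encodings reaches only the first child and the remaining tree, so the claim is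
    -- strengthened to all children at once.
    have key : ∀ b ∈ (t.children : Multiset RTree), motive b := by
      induction t with
      | leaf => exact fun b hb => absurd hb (Multiset.notMem_zero b)
      | cons a t iha iht =>
        intro b hb
        rcases Multiset.mem_cons.1
          (show b ∈ mk a ::ₘ (t.children : Multiset RTree) from hb) with rfl | hb
        · have := h _ iha
          rwa [show (a.children : Multiset RTree) = (mk a).children from rfl,
            Bplus_children] at this
        · exact iht b hb
    have := h _ key
    rwa [show (t.children : Multiset RTree) = children (mk t) from rfl, Bplus_children] at this

theorem size_cons (a t : RTree) : (cons a t).size = a.size + t.size := by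
  induction a using Quotient.ind
  induction t using Quotient.ind
  exact card_cons _ _

theorem size_Bplus (u : Multiset RTree) : (Bplus u).size = (u.map size).sum + 1 := by
  induction u using Multiset.induction with
  | empty => rfl
  | cons a u ih => rw [Bplus_cons, size_cons, ih, Multiset.map_cons, Multiset.sum_cons, add_assoc]

theorem symCard_ne_zero (t : RTree) : t.symCard ≠ 0 := by
  induction t using Quotient.ind with
  | _ t =>
    have : Finite (Vert t ≃o Vert t) :=
      Finite.of_injective (RelIso.toEquiv) fun _ _ h =>
        RelIso.toEquiv_injective h
    have : Nonempty (Vert t ≃o Vert t) := ⟨OrderIso.refl _⟩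
    exact Nat.card_ne_zero.2 ⟨inferInstance, inferInstance⟩

theorem symCard_bullet : bullet.symCard = 1 := by
  have : Subsingleton (Vert .leaf) := ⟨by rintro ⟨⟩ ⟨⟩; rfl⟩
  exact Nat.card_eq_one_iff_unique.2
    ⟨⟨fun e f => OrderIso.ext (funext fun v => Subsingleton.elim _ _)⟩, ⟨OrderIso.refl _⟩⟩

open Classical in
theorem card_iso (t s : PTree) :
    Nat.card (Vert t ≃o Vert s) = if mk t = mk s then (mk t).symCard else 0 := by
  split_ifs with h
  · obtain ⟨e⟩ := Quotient.exact h
    refine Nat.card_congr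
      { toFun := fun g => g.trans e.symm
        invFun := fun g => g.trans e
        left_inv := fun g => by ext v; simp
        right_inv := fun g => by ext v; simp }
  · have : IsEmpty (Vert t ≃o Vert s) := ⟨fun e => h (Quotient.sound ⟨e⟩)⟩
    exact Nat.card_of_isEmpty

open Classical in
theorem count_children (a : RTree) : ∀ t : PTree,
    (t.children : Multiset RTree).count a =
      ∑ c : t.Child, if a = mk (PTree.sub c) then 1 else 0
  | .leaf => rfl
  | .cons b t => by
    have h : (PTree.children (.cons b t) : Multiset RTree) =
      mk b ::ₘ (t.children : Multiset RTree) := rfl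
    rw [h, Multiset.count_cons, count_children a t]
    exact (add_comm _ _).trans (Fintype.sum_option (α := t.Child)
      (fun c : Option t.Child => if a = mk (PTree.sub (t := .cons b t) c) then 1 else 0)).symm

open Classical in
-- By `isoOfChild_bijective`, automorphisms of `cons a t` are counted by the child to which the
-- first one goes. Each child whose subtree is isomorphic to `a` contributes `|Sym a| |Sym t|`, the
-- others contribute nothing, and there are `count a + 1` children of the first kind.
theorem symCard_cons (a t : RTree) :
    (cons a t).symCard = (t.children.count a + 1) * (a.symCard * t.symCard) := by
  induction a using Quotient.ind with
  | _ a =>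
  induction t using Quotient.ind with
  | _ t =>
  change Nat.card (Vert (.cons a t) ≃o Vert (.cons a t)) = _
  have key : ∀ c : (PTree.cons a t).Child,
      Nat.card ((Vert a ≃o Vert (PTree.sub c)) × (Vert t ≃o Vert (PTree.del c))) =
        (if mk a = mk (PTree.sub c) then 1 else 0) * ((mk a).symCard * (mk t).symCard) := by
    intro c
    rw [Nat.card_prod, card_iso, card_iso]
    by_cases h : mk a = mk (PTree.sub c)
    · have h1 : mk t = mk (PTree.del c) := by
        have h2 := PTree.children_eq_cons c
        rw [← h] at h2
        have h3 : (mk t).children = (mk (PTree.del c)).children := (Multiset.cons_inj_right _).1 h2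
        rw [← Bplus_children (mk t), h3, Bplus_children]
      rw [if_pos h, if_pos h1, if_pos h, one_mul]
    · rw [if_neg h, if_neg h, zero_mul, zero_mul]
  have hfin : ∀ s s' : PTree, Finite (Vert s ≃o Vert s') := fun s s' =>
    Finite.of_injective RelIso.toEquiv RelIso.toEquiv_injective
  rw [← Nat.card_congr (Equiv.ofBijective _ Vert.isoOfChild_bijective),
    @Nat.card_sigma _ _ _ fun c => inferInstance,
    Finset.sum_congr rfl fun c _ => key c, ← Finset.sum_mul, ← count_children]
  congr 1
  exact Multiset.count_cons_self (mk a) (t.children : Multiset RTree)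

end RTree
end ConnesKreimer
end
noncomputable section
namespace ConnesKreimer

open scoped TensorProduct

/-! ## The universal property of the Connes–Kreimer algebra -/

section

variable {k : Type*} [Field k]

theorem forest_zero : forest k 0 = 1 := by simp [forest]

theorem forest_cons (t : RTree) (u : Multiset RTree) :
    forest k (t ::ₘ u) = MvPolynomial.X t * forest k u := by simp [forest]

theorem forest_add (u v : Multiset RTree) : forest k (u + v) = forest k u * forest k v := by
  simp [forest]

theorem monomial_eq_forest (d : RTree →₀ ℕ) :
    MvPolynomial.monomial d (1 : k) = forest k (Finsupp.toMultiset d) := by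
  induction d using Finsupp.induction with
  | zero => rw [map_zero, forest_zero]; rfl
  | single_add a b f _ _ ih =>
    rw [map_add, forest_add, ← ih, Finsupp.toMultiset_single, forest, Multiset.map_nsmul,
      Multiset.prod_nsmul, Multiset.map_singleton, Multiset.prod_singleton,
      MvPolynomial.X_pow_eq_monomial, MvPolynomial.monomial_mul, one_mul]

theorem exists_toMultiset_eq (u : Multiset RTree) : ∃ d, Finsupp.toMultiset d = u := by
  classical
  exact ⟨Multiset.toFinsupp u, Multiset.toFinsupp_toMultiset u⟩

theorem HK.linearMap_ext {M : Type*} [AddCommMonoid M] [Module k M] {f g : HK k →ₗ[k] M}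
    (h : ∀ u, f (forest k u) = g (forest k u)) : f = g := by
  refine (MvPolynomial.basisMonomials RTree k).ext fun d => ?_
  rw [MvPolynomial.coe_basisMonomials]
  change f (MvPolynomial.monomial d 1) = g (MvPolynomial.monomial d 1)
  rw [monomial_eq_forest, h]

theorem BplusTree_forest (u : Multiset RTree) :
    BplusTree k (forest k u) = Finsupp.single (RTree.Bplus u) 1 := by
  obtain ⟨d, rfl⟩ := exists_toMultiset_eq u
  rw [← monomial_eq_forest]
  exact (MvPolynomial.basisMonomials RTree k).constr_basis k
    (fun d => (Finsupp.single (RTree.Bplus (Finsupp.toMultiset d)) 1 : TreeSpace k)) d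

theorem Bplus_forest (u : Multiset RTree) :
    Bplus k (forest k u) = MvPolynomial.X (RTree.Bplus u) := by
  obtain ⟨d, rfl⟩ := exists_toMultiset_eq u
  rw [← monomial_eq_forest]
  exact (MvPolynomial.basisMonomials RTree k).constr_basis k
    (fun d => (MvPolynomial.X (RTree.Bplus (Finsupp.toMultiset d)) : HK k)) d

/-- Homomorphisms on the Connes–Kreimer algebra can be compared by induction along `B₊`. -/
theorem HK.algHom_ext {A : Type*} [CommSemiring A] [Algebra k A] {f g : HK k →ₐ[k] A}
    (h : ∀ u, f (forest k u) = g (forest k u) →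
      f (MvPolynomial.X (RTree.Bplus u)) = g (MvPolynomial.X (RTree.Bplus u))) : f = g := by
  refine MvPolynomial.algHom_ext fun t => ?_
  induction t using RTree.Bplus_induction with
  | h u ih =>
    refine h u ?_
    rw [forest, map_multiset_prod, map_multiset_prod, Multiset.map_map, Multiset.map_map]
    exact congrArg Multiset.prod (Multiset.map_congr rfl ih)

variable {A : Type*} [CommSemiring A] [Algebra k A]

/-- The value at the forest of the children of an encoded tree of the homomorphism that
intertwines `B₊` and `L`. -/
def evalChildren (L : A →ₗ[k] A) : PTree → A
  | .leaf => 1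
  | .cons a t => L (evalChildren L a) * evalChildren L t

/-- The value at the forest of the children of a tree of the homomorphism that intertwines `B₊`
and `L`. -/
def RTree.evalChildren (L : A →ₗ[k] A) : RTree → A :=
  Quotient.lift (ConnesKreimer.evalChildren L) fun _ _ ⟨e⟩ =>
    PTree.eq_of_iso (ConnesKreimer.evalChildren L) L (fun _ _ => rfl) e

/-- The homomorphism that intertwines `B₊` and `L`. -/
def initialHom (L : A →ₗ[k] A) : HK k →ₐ[k] A :=
  MvPolynomial.aeval fun t => L (RTree.evalChildren L t)

/-- The recursion on trees and the multiplicative extension from trees to forests agree; the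
intertwining property is then immediate. -/
theorem initialHom_forest (L : A →ₗ[k] A) (u : Multiset RTree) :
    initialHom L (forest k u) = RTree.evalChildren L (RTree.Bplus u) := by
  induction u using Multiset.induction with
  | empty => rw [forest_zero, map_one]; rfl
  | cons a u ih =>
    rw [forest_cons, map_mul, ih, initialHom, MvPolynomial.aeval_X, RTree.Bplus_cons]
    induction a using Quotient.ind
    induction RTree.Bplus u using Quotient.ind
    rfl

theorem initialHom_X (L : A →ₗ[k] A) (u : Multiset RTree) :
    initialHom L (MvPolynomial.X (RTree.Bplus u)) = L (initialHom L (forest k u)) := by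
  rw [initialHom_forest, initialHom, MvPolynomial.aeval_X]

theorem initialHom_Bplus (L : A →ₗ[k] A) (x : HK k) :
    initialHom L (Bplus k x) = L (initialHom L x) := by
  have : (initialHom L).toLinearMap ∘ₗ Bplus k = L ∘ₗ (initialHom L).toLinearMap :=
    HK.linearMap_ext fun u => by
      simp only [LinearMap.comp_apply, AlgHom.toLinearMap_apply, Bplus_forest, initialHom_X]
  exact LinearMap.congr_fun this x

theorem eq_initialHom (L : A →ₗ[k] A) (ρ : HK k →ₐ[k] A)
    (h : ∀ u, ρ (Bplus k (forest k u)) = L (ρ (forest k u))) : ρ = initialHom L :=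
  HK.algHom_ext fun u hu => by rw [← Bplus_forest, h, initialHom_Bplus, hu]

end

/-! ## The coproduct of the Connes–Kreimer algebra -/

section

variable (k : Type*) [Field k]

/-- The counit, which vanishes on nonempty forests. -/
def counit : HK k →ₐ[k] k := MvPolynomial.aeval fun _ => 0

variable {k} in
theorem counit_X (t : RTree) : counit k (MvPolynomial.X t) = 0 := MvPolynomial.aeval_X _ _

variable {k} in
open Classical in
theorem counit_forest (u : Multiset RTree) :
    counit k (forest k u) = if u = 0 then 1 else 0 := by
  induction u using Multiset.induction with
  | empty => rw [forest_zero, map_one, if_pos rfl]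
  | cons a u _ => rw [forest_cons, map_mul, counit_X, zero_mul, if_neg Multiset.cons_ne_zero]

/-- Contraction of the second factor of the tensor square. -/
def contractRight {k : Type*} [Field k] (φ : HK k →ₗ[k] k) : HK k ⊗[k] HK k →ₗ[k] HK k :=
  TensorProduct.lift ((LinearMap.lsmul k (HK k)).flip.compl₂ φ)

variable {k} in
theorem contractRight_tmul (φ : HK k →ₗ[k] k) (x y : HK k) :
    contractRight φ (x ⊗ₜ y) = φ y • x := rfl

/-- The operator `x ⊗ y ↦ ε(y) B₊(x) ⊗ 1 + x ⊗ B₊(y)` that corresponds to `B₊` under the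
coproduct. -/
def coproductBplus : HK k ⊗[k] HK k →ₗ[k] HK k ⊗[k] HK k :=
  Algebra.TensorProduct.includeLeft.toLinearMap ∘ₗ Bplus k ∘ₗ
      contractRight (counit k).toLinearMap +
    (Bplus k).lTensor (HK k)

/-- The Connes–Kreimer coproduct. -/
def coproduct : HK k →ₐ[k] HK k ⊗[k] HK k := initialHom (coproductBplus k)

variable {k}

/-- The counit axiom on the right. The universal property needs an operator on `HK ⊗ HK`, so
`coproductBplus` could only refer to `u` through `Δ(u)`; this recovers `u` and yields the usual
cocycle formula `coproduct_X`. The contraction is an algebra homomorphism and kills `x ⊗ B₊(y)`, so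
induction along `B₊` applies. -/
theorem contractRight_counit_coproduct (x : HK k) :
    contractRight (counit k).toLinearMap (coproduct k x) = x := by
  let f : HK k ⊗[k] HK k →ₐ[k] HK k :=
    Algebra.TensorProduct.productMap (AlgHom.id k _) ((Algebra.ofId k _).comp (counit k))
  have hf : contractRight (counit k).toLinearMap = f.toLinearMap := by
    refine TensorProduct.ext' fun x y => ?_
    rw [contractRight_tmul, AlgHom.toLinearMap_apply, AlgHom.toLinearMap_apply,
      Algebra.TensorProduct.productMap_apply_tmul, Algebra.smul_def, mul_comm]
    rfl
  rw [hf]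
  have hB : ∀ z, f ((Bplus k).lTensor (HK k) z) = 0 := fun z => by
    have : f.toLinearMap ∘ₗ (Bplus k).lTensor (HK k) = 0 := by
      refine TensorProduct.ext' fun x y => ?_
      have hy : (counit k).toLinearMap ∘ₗ Bplus k = 0 := HK.linearMap_ext fun u => by
        simp [Bplus_forest, counit_X]
      have hy' : counit k (Bplus k y) = 0 := LinearMap.congr_fun hy y
      simp [f, hy']
    exact LinearMap.congr_fun this z
  suffices h : f.comp (coproduct k) = AlgHom.id k _ from DFunLike.congr_fun h x
  refine HK.algHom_ext fun u hu => ?_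
  have hu' : contractRight (counit k).toLinearMap (coproduct k (forest k u)) = forest k u := by
    rw [hf]
    exact hu
  rw [AlgHom.comp_apply, coproduct, initialHom_X, coproductBplus, LinearMap.add_apply, map_add, hB,
    add_zero]
  change f (Bplus k (contractRight _ (coproduct k (forest k u))) ⊗ₜ 1) = _
  rw [hu', Bplus_forest]
  simp [f]

theorem coproduct_X (u : Multiset RTree) :
    coproduct k (MvPolynomial.X (RTree.Bplus u)) = MvPolynomial.X (RTree.Bplus u) ⊗ₜ 1 +
      (Bplus k).lTensor (HK k) (coproduct k (forest k u)) := by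
  rw [← Bplus_forest]
  conv_lhs => rw [coproduct, initialHom_Bplus, coproductBplus, LinearMap.add_apply]
  change Bplus k (contractRight _ (coproduct k (forest k u))) ⊗ₜ 1 + _ = _
  rw [contractRight_counit_coproduct]
  rfl

end

/-! ## Derivations and the pairing -/

theorem derivation_multiset_prod {k B ι : Type*} [CommSemiring k] [CommSemiring B] [Algebra k B]
    [DecidableEq ι] (D : Derivation k B B) (f : ι → B) (s : Multiset ι) :
    D (s.map f).prod = (s.map fun i => D (f i) * ((s.erase i).map f).prod).sum := by
  induction s using Multiset.induction with
  | empty => simp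
  | cons i s ih =>
    rw [Multiset.map_cons, Multiset.prod_cons, D.leibniz, ih, Multiset.map_cons, Multiset.sum_cons,
      Multiset.erase_cons_head, smul_eq_mul, smul_eq_mul, add_comm, mul_comm (Multiset.prod _),
      ← Multiset.sum_map_mul_left]
    congr 2
    refine Multiset.map_congr rfl fun j hj => ?_
    rw [Multiset.erase_cons_tail_of_mem hj, Multiset.map_cons, Multiset.prod_cons, mul_left_comm]

theorem sum_map_ite_eq_count {M ι : Type*} [AddCommMonoid M] [DecidableEq ι] (a : ι) (c : M)
    (s : Multiset ι) : (s.map fun b => if a = b then c else 0).sum = s.count a • c := by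
  induction s using Multiset.induction with
  | empty => simp
  | cons b s ih =>
    rw [Multiset.map_cons, Multiset.sum_cons, ih, Multiset.count_cons, add_smul, add_comm,
      ite_smul, one_smul, zero_smul]

/-- The extension of a derivation to the right factor of a tensor product. -/
def derivationLTensor {k B : Type*} [CommRing k] [CommRing B] [Algebra k B]
    (D : Derivation k B B) : Derivation k (B ⊗[k] B) (B ⊗[k] B) :=
  Derivation.mk' (D.toLinearMap.lTensor B) fun x y => by
    induction x with
    | zero => simp
    | add x x' hx hx' => rw [add_mul, map_add, hx, hx', map_add, add_smul, smul_add]; abel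
    | tmul a b =>
      induction y with
      | zero => simp
      | add y y' hy hy' => rw [mul_add, map_add, hy, hy', map_add, add_smul, smul_add]; abel
      | tmul c d =>
        simp only [Algebra.TensorProduct.tmul_mul_tmul, LinearMap.lTensor_tmul, smul_eq_mul,
          Derivation.coeFn_coe, Derivation.leibniz,
          TensorProduct.tmul_add, mul_comm c a]

section

variable (k : Type*) [Field k]

/-- The pairing `⟨T, u⟩` as a bilinear map. -/
def pairL : TreeSpace k →ₗ[k] HK k →ₗ[k] k := (treeInner k).compl₂ (BplusTree k)

variable {k}

theorem pairL_apply (T : TreeSpace k) (x : HK k) : pairL k T x = pairTree k T x := rfl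

open Classical in
theorem pairL_single_forest (t : RTree) (u : Multiset RTree) :
    pairL k (Finsupp.single t 1) (forest k u) = if t = RTree.Bplus u then (t.symCard : k) else 0 := by
  rw [pairL_apply, pairTree, BplusTree_forest, treeInner, Finsupp.lift_apply,
    Finsupp.sum_single_index (by rw [zero_smul]), one_smul, LinearMap.smul_apply, Finsupp.lapply_apply,
    Finsupp.single_apply, smul_eq_mul, mul_ite, mul_one, mul_zero]
  exact if_congr eq_comm rfl rfl

theorem pairL_bullet (x : HK k) : pairL k (Finsupp.single RTree.bullet 1) x = counit k x := by
  classical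
  have : pairL k (Finsupp.single RTree.bullet 1) = (counit k).toLinearMap :=
    HK.linearMap_ext fun u => by
      rw [pairL_single_forest, AlgHom.toLinearMap_apply, counit_forest, RTree.symCard_bullet,
        Nat.cast_one]
      refine if_congr ⟨fun h => (RTree.Bplus_injective (RTree.Bplus_zero.trans h)).symm, ?_⟩ rfl rfl
      rintro rfl
      rfl
  exact LinearMap.congr_fun this x

/-- The derivation of the Connes–Kreimer algebra that maps a tree `b` to its inner product
with `T`. -/
def treeDerivation (T : TreeSpace k) : Derivation k (HK k) (HK k) :=
  MvPolynomial.mkDerivation k fun b => MvPolynomial.C (pairL k T (forest k b.children))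

theorem treeDerivation_X (T : TreeSpace k) (b : RTree) :
    treeDerivation T (MvPolynomial.X b) = MvPolynomial.C (pairL k T (forest k b.children)) :=
  MvPolynomial.mkDerivation_X _ _ _

theorem treeDerivation_Bplus (T : TreeSpace k) (x : HK k) :
    treeDerivation T (Bplus k x) = MvPolynomial.C (pairL k T x) := by
  have : (treeDerivation T).toLinearMap ∘ₗ Bplus k = Algebra.linearMap k (HK k) ∘ₗ pairL k T :=
    HK.linearMap_ext fun u => by
      simp only [LinearMap.comp_apply, Derivation.coeFn_coe,
        Bplus_forest, treeDerivation_X, RTree.children_Bplus]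
      rfl
  exact LinearMap.congr_fun this x

open Classical in
theorem treeDerivation_forest (T : TreeSpace k) (u : Multiset RTree) :
    treeDerivation T (forest k u) =
      (u.map fun b => pairL k T (forest k b.children) • forest k (u.erase b)).sum := by
  rw [forest, derivation_multiset_prod]
  refine congrArg Multiset.sum (Multiset.map_congr rfl fun b _ => ?_)
  rw [treeDerivation_X, ← MvPolynomial.smul_eq_C_mul]
  rfl

/-- On a forest `u` the derivation gives `count a u · |Sym a|` times `u` without one copy of `a`.
Pairing with `t` is nonzero only for `u = a · children(t)`, at least formally, and there the
equality is the recursion `RTree.symCard_cons`. -/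
theorem pairL_single_cons (a t : RTree) (x : HK k) :
    pairL k (Finsupp.single (RTree.cons a t) 1) x =
      pairL k (Finsupp.single t 1) (treeDerivation (Finsupp.single a 1) x) := by
  classical
  have : pairL k (Finsupp.single (RTree.cons a t) 1) =
      pairL k (Finsupp.single t 1) ∘ₗ (treeDerivation (Finsupp.single a 1)).toLinearMap := by
    refine HK.linearMap_ext fun u => ?_
    rw [LinearMap.comp_apply, Derivation.coeFn_coe,
      treeDerivation_forest, map_multiset_sum, Multiset.map_map]
    have h1 : ∀ b ∈ u, (pairL k (Finsupp.single t 1) ∘ fun b =>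
        pairL k (Finsupp.single a 1) (forest k b.children) • forest k (u.erase b)) b =
        if a = b then (a.symCard : k) * pairL k (Finsupp.single t 1) (forest k (u.erase a))
          else 0 := by
      intro b _
      rw [Function.comp_apply, map_smul, pairL_single_forest, RTree.Bplus_children, smul_eq_mul]
      split_ifs with h
      · rw [h]
      · rw [zero_mul]
    rw [Multiset.map_congr rfl h1, sum_map_ite_eq_count, pairL_single_forest,
      pairL_single_forest]
    by_cases h : a ∈ u
    · obtain ⟨v, rfl⟩ := Multiset.exists_cons_of_mem h
      rw [Multiset.erase_cons_head, RTree.Bplus_cons, RTree.cons_children, ← RTree.Bplus_cons]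
      by_cases h2 : t = RTree.Bplus v
      · subst h2
        rw [RTree.children_Bplus, if_pos rfl, if_pos rfl, RTree.Bplus_cons, RTree.symCard_cons,
          RTree.children_Bplus, Multiset.count_cons_self]
        simp [nsmul_eq_mul]
      · rw [if_neg h2, if_neg, mul_zero, smul_zero]
        intro h3
        apply h2
        rw [← RTree.Bplus_children t,
          (Multiset.cons_inj_right _).1 (RTree.Bplus_injective h3)]
    · rw [Multiset.count_eq_zero_of_notMem h, zero_smul, if_neg]
      rw [RTree.cons_children]
      intro h3
      exact h (RTree.Bplus_injective h3 ▸ Multiset.mem_cons_self _ _)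
  exact LinearMap.congr_fun this x

theorem treeDerivation_add (S T : TreeSpace k) (x : HK k) :
    treeDerivation (S + T) x = treeDerivation S x + treeDerivation T x := by
  have : treeDerivation (S + T) = treeDerivation S + treeDerivation T :=
    MvPolynomial.derivation_ext fun b => by
      rw [Derivation.add_apply, treeDerivation_X, treeDerivation_X, treeDerivation_X, map_add,
        LinearMap.add_apply, map_add]
  exact DFunLike.congr_fun this x

theorem treeDerivation_smul (c : k) (T : TreeSpace k) (x : HK k) :
    treeDerivation (c • T) x = c • treeDerivation T x := by
  have : treeDerivation (c • T) = c • treeDerivation T :=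
    MvPolynomial.derivation_ext fun b => by
      rw [Derivation.smul_apply, treeDerivation_X, treeDerivation_X, map_smul,
        LinearMap.smul_apply, smul_eq_mul, map_mul, MvPolynomial.smul_eq_C_mul]
  exact DFunLike.congr_fun this x

variable (k) in
/-- The bilinear extension of `RTree.cons`. -/
def consL : TreeSpace k →ₗ[k] TreeSpace k →ₗ[k] TreeSpace k :=
  Finsupp.lift _ k RTree fun s => Finsupp.lift _ k RTree fun t =>
    Finsupp.single (RTree.cons s t) 1

theorem consL_single (s t : RTree) :
    consL k (Finsupp.single s 1) (Finsupp.single t 1) = Finsupp.single (RTree.cons s t) 1 := by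
  simp [consL]

theorem pairL_consL (S T : TreeSpace k) (x : HK k) :
    pairL k (consL k S T) x = pairL k T (treeDerivation S x) := by
  induction S using Finsupp.induction_linear with
  | zero =>
    have := treeDerivation_smul (0 : k) 0 x
    rw [zero_smul, zero_smul] at this
    simp [this]
  | add S S' h h' =>
    rw [map_add, LinearMap.add_apply, map_add, LinearMap.add_apply, h, h', treeDerivation_add,
      map_add]
  | single s c =>
    rw [← Finsupp.smul_single_one s c, map_smul, LinearMap.smul_apply, map_smul,
      LinearMap.smul_apply, treeDerivation_smul, map_smul]
    congr 1
    induction T using Finsupp.induction_linear with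
    | zero => simp
    | add T T' h h' =>
      rw [map_add, map_add, LinearMap.add_apply, h, h', map_add, LinearMap.add_apply]
    | single t c =>
      rw [← Finsupp.smul_single_one t c, map_smul, map_smul, LinearMap.smul_apply, map_smul,
        LinearMap.smul_apply, consL_single, pairL_single_cons]

end

end ConnesKreimer
end
noncomputable section
namespace ConnesKreimer

open scoped TensorProduct

/-! ## The Grossman–Larson product by recursion on the second factor -/

section

variable (k : Type*) [Field k]

/-- The sum of the trees obtained by attaching to each vertex `v` of an encoded tree the trees in
`g v`, and each of the trees in `w` to some vertex. -/
def attach : (t : PTree) → (Vert t → Multiset RTree) → Multiset RTree → TreeSpace k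
  | .leaf, g, w => Finsupp.single (RTree.Bplus (g .pt + w)) 1
  | .cons a t, g, w => (w.antidiagonal.map fun p =>
      consL k (attach a (fun v => g (.inl v)) p.1) (attach t (fun v => g (.inr v)) p.2)).sum

variable {k}

theorem attach_zero : ∀ (t : PTree) (g : Vert t → Multiset RTree),
    attach k t g 0 = Finsupp.single (graft t g) 1
  | .leaf, g => by rw [attach, graft, add_zero]
  | .cons a t, g => by
    rw [attach, Multiset.antidiagonal_zero, Multiset.map_singleton, Multiset.sum_singleton,
      attach_zero a, attach_zero t, consL_single, graft]

open Classical in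
-- One tree may be placed first, at each vertex in turn, and recorded in `g`.
-- `Multiset.antidiagonal` counts splittings with multiplicity, so equal trees in `w` behave as
-- labelled ones, as they do in the sum over maps in `attachSum`.
theorem attach_cons (b : RTree) : ∀ (t : PTree) (g : Vert t → Multiset RTree) (w : Multiset RTree),
    attach k t g (b ::ₘ w) =
      ∑ x : Vert t, attach k t (fun v => g v + if x = v then {b} else 0) w
  | .leaf, g, w => by
    have hu : (Finset.univ : Finset (Vert .leaf)) = {.pt} := rfl
    rw [hu, Finset.sum_singleton, attach, attach, if_pos rfl, add_assoc, Multiset.singleton_add]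
  | .cons a t, g, w => by
    have hu : ∀ F : Vert (.cons a t) → TreeSpace k,
        ∑ x, F x = ∑ x : Vert a, F (.inl x) + ∑ x : Vert t, F (.inr x) := fun F => by
      rw [← Fintype.sum_equiv (Vert.sumEquiv a t) (fun x => F (Vert.sumEquiv a t x)) F
        fun _ => rfl, Fintype.sum_sum_type]
      rfl
    have hswap : ∀ {t : PTree} (F : Vert t → Multiset RTree × Multiset RTree → TreeSpace k),
        ∑ x, (w.antidiagonal.map (F x)).sum = (w.antidiagonal.map fun p => ∑ x, F x p).sum :=
      fun F => Multiset.sum_map_sum_map _ _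
    have h1 : ∀ (x : Vert a) (v : Vert t), (Vert.inl x : Vert (.cons a t)) ≠ .inr v := nofun
    have h2 : ∀ (x : Vert t) (v : Vert a), (Vert.inr x : Vert (.cons a t)) ≠ .inl v := nofun
    rw [hu]
    simp only [attach, Vert.inl.injEq, Vert.inr.injEq, h1, h2, if_false, add_zero]
    rw [Multiset.antidiagonal_cons, Multiset.map_add, Multiset.sum_add, Multiset.map_map,
      Multiset.map_map, add_comm, hswap, hswap]
    congr 2
    · refine Multiset.map_congr rfl fun p _ => ?_
      change consL k (attach k a _ (b ::ₘ p.1)) (attach k t _ p.2) = _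
      rw [attach_cons b a, map_sum, LinearMap.sum_apply]
    · refine Multiset.map_congr rfl fun p _ => ?_
      change consL k (attach k a _ p.1) (attach k t _ (b ::ₘ p.2)) = _
      rw [attach_cons b t, map_sum]

open Classical in
-- A map from the positions of `b :: l` to the vertices is a vertex for `b` and a map for `l`; the
-- accumulated decoration `g` makes the induction go through.
theorem sum_graft_eq_attach (t : PTree) : ∀ (l : List RTree) (g : Vert t → Multiset RTree),
    ∑ f : Fin l.length → Vert t, Finsupp.single
      (graft t fun v => g v + (Finset.univ.filter fun i => f i = v).val.map l.get) (1 : k) =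
    attach k t g l
  | [], g => by
    have : Unique (Fin ([] : List RTree).length → Vert t) :=
      inferInstanceAs (Unique (Fin 0 → Vert t))
    rw [Multiset.coe_nil, attach_zero, Fintype.sum_unique]
    simp
  | b :: l, g => by
    rw [← Multiset.cons_coe, attach_cons]
    refine (Fintype.sum_equiv (Fin.consEquiv fun _ : Fin (l.length + 1) => Vert t) _ _
      fun _ => rfl).symm.trans ?_
    rw [Fintype.sum_prod_type]
    refine Finset.sum_congr rfl fun x _ => ?_
    rw [← sum_graft_eq_attach t l]
    refine Finset.sum_congr rfl fun f _ => ?_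
    congr 2
    funext v
    rw [add_assoc]
    congr 1
    change Multiset.map (b :: l).get (Finset.univ.filter fun i : Fin (l.length + 1) =>
      (Fin.cons x f : Fin (l.length + 1) → Vert t) i = v).val = _
    rw [Fin.univ_succ, Finset.filter_cons]
    split_ifs with h1 h2 h2
    · simp [Finset.filter_map]
    · exact (h2 h1).elim
    · exact (h1 h2).elim
    · simp [Finset.filter_map]

theorem attachSum_eq_attach (l : List RTree) (t : PTree) :
    attachSum k l t = attach k t (fun _ => 0) l := by
  rw [← sum_graft_eq_attach, attachSum]
  simp only [zero_add]

/-! ## Duality of the Grossman–Larson product and the Connes–Kreimer coproduct -/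

/-- The functional `x ⊗ y ↦ φ(x) ψ(y)` on the tensor square. -/
def tensorPair (φ ψ : HK k →ₗ[k] k) : HK k ⊗[k] HK k →ₗ[k] k :=
  TensorProduct.lift ((LinearMap.mul k k).compl₁₂ φ ψ)

theorem tensorPair_tmul (φ ψ : HK k →ₗ[k] k) (x y : HK k) :
    tensorPair φ ψ (x ⊗ₜ y) = φ x * ψ y := rfl

theorem apply_contractRight (φ ψ : HK k →ₗ[k] k) (z : HK k ⊗[k] HK k) :
    φ (contractRight ψ z) = tensorPair φ ψ z := by
  induction z with
  | zero => simp
  | add z z' h h' => rw [map_add, map_add, map_add, h, h']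
  | tmul x y => rw [contractRight_tmul, tensorPair_tmul, map_smul, smul_eq_mul, mul_comm]

theorem tensorPair_lTensor (φ ψ : HK k →ₗ[k] k) (D : HK k →ₗ[k] HK k) (z : HK k ⊗[k] HK k) :
    tensorPair φ ψ (D.lTensor (HK k) z) = tensorPair φ (ψ ∘ₗ D) z := by
  induction z with
  | zero => simp
  | add z z' h h' => rw [map_add, map_add, map_add, h, h']
  | tmul x y => rfl

/-- The pairing is compatible with the product of forests. -/
theorem pairL_Bplus_mul (w : Multiset RTree) (x y : HK k) :
    pairL k (Finsupp.single (RTree.Bplus w) 1) (x * y) =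
      (w.antidiagonal.map fun p => pairL k (Finsupp.single (RTree.Bplus p.1) 1) x *
        pairL k (Finsupp.single (RTree.Bplus p.2) 1) y).sum := by
  induction w using Multiset.induction generalizing x y with
  | empty =>
    simp only [Multiset.antidiagonal_zero, Multiset.map_singleton, Multiset.sum_singleton,
      RTree.Bplus_zero, pairL_bullet, map_mul]
  | cons a w ih =>
    -- The two terms of the Leibniz rule correspond to the tree `a` going to one or the other half
    -- of the splitting.
    rw [RTree.Bplus_cons, pairL_single_cons, Derivation.leibniz, map_add, smul_eq_mul, smul_eq_mul,
      ih, mul_comm y, ih, Multiset.antidiagonal_cons, Multiset.map_add, Multiset.sum_add,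
      Multiset.map_map, Multiset.map_map]
    simp only [Function.comp_def, Prod.map_fst, Prod.map_snd, id, RTree.Bplus_cons,
      pairL_single_cons]

theorem tensorPair_Bplus_mul (w : Multiset RTree) (ψ : HK k →ₗ[k] k) (x : HK k)
    (z : HK k ⊗[k] HK k) :
    tensorPair (pairL k (Finsupp.single (RTree.Bplus w) 1)) ψ ((x ⊗ₜ 1) * z) =
      (w.antidiagonal.map fun p => pairL k (Finsupp.single (RTree.Bplus p.1) 1) x *
        tensorPair (pairL k (Finsupp.single (RTree.Bplus p.2) 1)) ψ z).sum := by
  induction z with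
  | zero => simp
  | add z z' h h' => simp only [mul_add, map_add, h, h', Multiset.sum_map_add]
  | tmul y y' =>
    rw [Algebra.TensorProduct.tmul_mul_tmul, one_mul, tensorPair_tmul, pairL_Bplus_mul,
      ← Multiset.sum_map_mul_right]
    simp only [tensorPair_tmul, mul_assoc]

theorem lTensor_treeDerivation_Bplus (T : TreeSpace k) (z : HK k ⊗[k] HK k) :
    (treeDerivation T).toLinearMap.lTensor (HK k) ((Bplus k).lTensor (HK k) z) =
      contractRight (pairL k T) z ⊗ₜ 1 := by
  induction z with
  | zero => simp
  | add z z' h h' => rw [map_add, map_add, map_add, h, h', TensorProduct.add_tmul]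
  | tmul x y =>
    rw [LinearMap.lTensor_tmul, LinearMap.lTensor_tmul, contractRight_tmul]
    change x ⊗ₜ treeDerivation T (Bplus k y) = _
    rw [treeDerivation_Bplus, TensorProduct.smul_tmul, MvPolynomial.smul_eq_C_mul, mul_one]

open Classical in
/-- The derivation of the right factor of the coproduct of a forest. -/
theorem lTensor_treeDerivation_coproduct (T : TreeSpace k) (u : Multiset RTree) :
    (treeDerivation T).toLinearMap.lTensor (HK k) (coproduct k (forest k u)) =
      (u.map fun b => (contractRight (pairL k T) (coproduct k (forest k b.children)) ⊗ₜ 1) *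
        coproduct k (forest k (u.erase b))).sum := by
  change derivationLTensor (treeDerivation T) (coproduct k (forest k u)) = _
  rw [forest, map_multiset_prod, Multiset.map_map, derivation_multiset_prod]
  refine congrArg Multiset.sum (Multiset.map_congr rfl fun b _ => ?_)
  have he : coproduct k (forest k (u.erase b)) =
      ((u.erase b).map (coproduct k ∘ MvPolynomial.X)).prod := by
    rw [forest, map_multiset_prod, Multiset.map_map]
  rw [he]
  congr 1
  -- In `Δ(b) = b ⊗ 1 + (id ⊗ B₊) Δ(children)` the derivation kills the first term, and in the
  -- second it undoes `B₊` by `treeDerivation_Bplus`.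
  have h := coproduct_X (k := k) b.children
  rw [RTree.Bplus_children] at h
  rw [Function.comp_apply, h, map_add]
  change (MvPolynomial.X b : HK k) ⊗ₜ[k] treeDerivation T 1 + _ = _
  rw [Derivation.map_one_eq_zero, TensorProduct.tmul_zero, zero_add]
  exact lTensor_treeDerivation_Bplus T _

/-- Duality by recursion on the tree that receives the attachments. For one vertex it is the counit
axiom. For `cons a t`, the derivation of `a` applied to the right factor of `Δ(u)` singles out a
tree `b` of `u`; pairing the resulting product with `B₊(w)` splits `w` into what is attached to `a`
and what is attached to `t`, as in `attach`. -/
theorem pairL_attach : ∀ (t : PTree) (w : Multiset RTree) (x : HK k),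
    pairL k (attach k t (fun _ => 0) w) x =
      tensorPair (pairL k (Finsupp.single (RTree.Bplus w) 1))
        (pairL k (Finsupp.single (RTree.mk t) 1)) (coproduct k x)
  | .leaf, w, x => by
    have h : pairL k (Finsupp.single (RTree.mk .leaf) 1) = (counit k).toLinearMap :=
      LinearMap.ext pairL_bullet
    rw [h, ← apply_contractRight, contractRight_counit_coproduct, attach, zero_add]
  | .cons a t, w, x => by
    classical
    suffices h : pairL k (attach k (.cons a t) (fun _ => 0) w) =
        tensorPair (pairL k (Finsupp.single (RTree.Bplus w) 1))
          (pairL k (Finsupp.single (RTree.mk (.cons a t)) 1)) ∘ₗ (coproduct k).toLinearMap from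
      LinearMap.congr_fun h x
    refine HK.linearMap_ext fun u => ?_
    have hc : pairL k (Finsupp.single (RTree.mk (.cons a t)) 1) =
        pairL k (Finsupp.single (RTree.mk t) 1) ∘ₗ
          (treeDerivation (Finsupp.single (RTree.mk a) 1)).toLinearMap :=
      LinearMap.ext (pairL_single_cons (RTree.mk a) (RTree.mk t))
    rw [LinearMap.comp_apply, AlgHom.toLinearMap_apply, hc, ← tensorPair_lTensor,
      lTensor_treeDerivation_coproduct, map_multiset_sum, Multiset.map_map, attach,
      map_multiset_sum, Multiset.map_map]
    have h1 : ∀ S : Multiset (HK k →ₗ[k] k), ∀ y : HK k, S.sum y = (S.map fun φ => φ y).sum :=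
      fun S y => map_multiset_sum (LinearMap.applyₗ (R := k) y) S
    rw [h1, Multiset.map_map]
    simp only [Function.comp_def, tensorPair_Bplus_mul, apply_contractRight, pairL_consL,
      treeDerivation_forest, map_multiset_sum, Multiset.map_map, map_smul, smul_eq_mul,
      pairL_attach a, pairL_attach t]
    -- Only the order of summation differs: over the splittings of `w` and over the trees `b` of
    -- `u`.
    exact Multiset.sum_map_sum_map _ _

theorem pairL_glTree (s t : RTree) (x : HK k) :
    pairL k (glTree k s t) x =
      tensorPair (pairL k (Finsupp.single s 1)) (pairL k (Finsupp.single t 1)) (coproduct k x) := by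
  have hs : RTree.Bplus ((Quotient.out s).children : Multiset RTree) = s := by
    have h : ((Quotient.out s).children : Multiset RTree) = s.children :=
      congrArg RTree.children (Quotient.out_eq s)
    rw [h, RTree.Bplus_children]
  have ht : RTree.mk (Quotient.out t) = t := Quotient.out_eq t
  rw [glTree, attachSum_eq_attach, pairL_attach, hs, ht]

/-- The Grossman–Larson product is dual to the Connes–Kreimer coproduct. -/
theorem pairL_gl (S T : TreeSpace k) (x : HK k) :
    pairL k (gl k S T) x = tensorPair (pairL k S) (pairL k T) (coproduct k x) := by
  generalize hz : coproduct k x = z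
  have hadd : ∀ φ φ' ψ : HK k →ₗ[k] k,
      tensorPair (φ + φ') ψ z = tensorPair φ ψ z + tensorPair φ' ψ z := fun φ φ' ψ => by
    rw [← apply_contractRight, ← apply_contractRight, ← apply_contractRight, LinearMap.add_apply]
  have hsmul : ∀ (c : k) (φ ψ : HK k →ₗ[k] k),
      tensorPair (c • φ) ψ z = c * tensorPair φ ψ z := fun c φ ψ => by
    rw [← apply_contractRight, ← apply_contractRight, LinearMap.smul_apply, smul_eq_mul]
  have hadd' : ∀ φ ψ ψ' : HK k →ₗ[k] k,
      tensorPair φ (ψ + ψ') z = tensorPair φ ψ z + tensorPair φ ψ' z := fun φ ψ ψ' => by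
    have : tensorPair φ (ψ + ψ') = tensorPair φ ψ + tensorPair φ ψ' :=
      TensorProduct.ext' fun x y => mul_add _ _ _
    rw [this, LinearMap.add_apply]
  have hsmul' : ∀ (c : k) (φ ψ : HK k →ₗ[k] k),
      tensorPair φ (c • ψ) z = c * tensorPair φ ψ z := fun c φ ψ => by
    have : tensorPair φ (c • ψ) = c • tensorPair φ ψ :=
      TensorProduct.ext' fun x y => mul_left_comm _ _ _
    rw [this, LinearMap.smul_apply, smul_eq_mul]
  induction S using Finsupp.induction_linear with
  | zero =>
    have := hsmul 0 0 (pairL k T)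
    rw [zero_smul, zero_mul] at this
    simp [this]
  | add S S' h h' =>
    rw [map_add, LinearMap.add_apply, map_add, LinearMap.add_apply, h, h', map_add, hadd]
  | single s c =>
    rw [← Finsupp.smul_single_one s c, map_smul, LinearMap.smul_apply, map_smul,
      LinearMap.smul_apply, map_smul, hsmul, smul_eq_mul]
    congr 1
    induction T using Finsupp.induction_linear with
    | zero =>
      have := hsmul' 0 (pairL k (Finsupp.single s 1)) 0
      rw [zero_smul, zero_mul] at this
      simp [this]
    | add T T' h h' =>
      rw [map_add, map_add, LinearMap.add_apply, h, h', map_add, hadd']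
    | single t c =>
      rw [← Finsupp.smul_single_one t c, map_smul, map_smul, map_smul, LinearMap.smul_apply,
        hsmul', smul_eq_mul, ← hz, ← pairL_glTree]
      simp [gl]

end

end ConnesKreimer
end
noncomputable section
namespace ConnesKreimer

open scoped TensorProduct

/-! ## The functionals of `κₙ` and `εₙ` -/

section

variable (k : Type*) [Field k]

open Classical in
/-- The generating function of the `εₙ` as a character of the Connes–Kreimer algebra. -/
def epsilonChar : HK k →ₐ[k] PowerSeries k :=
  MvPolynomial.aeval fun t => if t = RTree.bullet then PowerSeries.X else 0

/-- The generating function of the `(-1)ⁿ κₙ` as a character of the Connes–Kreimer algebra. -/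
def kappaChar : HK k →ₐ[k] PowerSeries k :=
  MvPolynomial.aeval fun t => (-PowerSeries.X) ^ t.size

variable {k}

theorem epsilonChar_X (u : Multiset RTree) :
    epsilonChar k (MvPolynomial.X (RTree.Bplus u)) =
      counit k (forest k u) • (PowerSeries.X : PowerSeries k) := by
  classical
  rw [epsilonChar, MvPolynomial.aeval_X, counit_forest, ite_smul, one_smul, zero_smul]
  exact if_congr ⟨fun h => RTree.Bplus_injective (h.trans RTree.Bplus_zero.symm), fun h => by
    rw [h, RTree.Bplus_zero]⟩ rfl rfl

theorem epsilonChar_Bplus (x : HK k) :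
    epsilonChar k (Bplus k x) = counit k x • (PowerSeries.X : PowerSeries k) := by
  have : (epsilonChar k).toLinearMap ∘ₗ Bplus k =
      (counit k).toLinearMap.smulRight (PowerSeries.X : PowerSeries k) :=
    HK.linearMap_ext fun u => by
      rw [LinearMap.comp_apply, Bplus_forest]
      exact epsilonChar_X u
  exact LinearMap.congr_fun this x

theorem kappaChar_forest (u : Multiset RTree) :
    kappaChar k (forest k u) = (-PowerSeries.X) ^ (u.map RTree.size).sum := by
  induction u using Multiset.induction with
  | empty => rw [forest_zero, map_one, Multiset.map_zero, Multiset.sum_zero, pow_zero]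
  | cons a u ih =>
    rw [forest_cons, map_mul, ih, kappaChar, MvPolynomial.aeval_X, Multiset.map_cons,
      Multiset.sum_cons, pow_add]

/-- The weight `1 / |Sym t|` in `κₙ` cancels `(t, t)`; characteristic zero keeps `|Sym t|`
invertible. -/
theorem pairL_kappa_forest [CharZero k] (n : ℕ) (u : Multiset RTree) :
    pairL k (kappa k n) (forest k u) = if (u.map RTree.size).sum = n then 1 else 0 := by
  classical
  have h : ∀ t : RTree, pairL k (Finsupp.single t (t.symCard : k)⁻¹) (forest k u) =
      if t = RTree.Bplus u then 1 else 0 := fun t => by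
    have ht : (t.symCard : k) ≠ 0 := Nat.cast_ne_zero.2 t.symCard_ne_zero
    rw [← Finsupp.smul_single_one, map_smul, LinearMap.smul_apply, pairL_single_forest, smul_ite,
      smul_zero, smul_eq_mul, inv_mul_cancel₀ ht]
  rw [kappa, map_sum, LinearMap.sum_apply, Finset.sum_congr rfl fun t _ => h t,
    Finset.sum_ite_eq']
  refine if_congr ?_ rfl rfl
  rw [RTree.ofSize, Set.Finite.mem_toFinset]
  change (RTree.Bplus u).size = n + 1 ↔ _
  rw [RTree.size_Bplus, Nat.add_right_cancel_iff]

theorem coeff_kappaChar [CharZero k] (n : ℕ) :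
    PowerSeries.coeff (R := k) n ∘ₗ (kappaChar k).toLinearMap =
      (-1 : k) ^ n • pairL k (kappa k n) := by
  refine HK.linearMap_ext fun u => ?_
  rw [LinearMap.comp_apply, AlgHom.toLinearMap_apply, kappaChar_forest, LinearMap.smul_apply,
    pairL_kappa_forest, neg_pow, ← map_one (PowerSeries.C (R := k)), ← map_neg, ← map_pow,
    PowerSeries.coeff_C_mul, PowerSeries.coeff_X_pow, smul_eq_mul]
  split_ifs with h1 h2 h2
  · rw [h1]
  · exact (h2 h1.symm).elim
  · exact (h1 h2.symm).elim
  · rw [mul_zero, mul_zero]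

/-- The coproduct is counital on the left. -/
theorem tensorPair_counit_coproduct (φ : HK k →ₗ[k] k) (x : HK k) :
    tensorPair (counit k).toLinearMap φ (coproduct k x) = φ x := by
  let f : HK k ⊗[k] HK k →ₐ[k] HK k :=
    Algebra.TensorProduct.productMap ((Algebra.ofId k _).comp (counit k)) (AlgHom.id k _)
  have hft : ∀ x y, f (x ⊗ₜ y) = counit k x • y := fun x y =>
    (Algebra.TensorProduct.productMap_apply_tmul _ _ x y).trans
      (Algebra.smul_def (counit k x) y).symm
  have hf : tensorPair (counit k).toLinearMap φ = φ ∘ₗ f.toLinearMap := by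
    refine TensorProduct.ext' fun x y => ?_
    rw [LinearMap.comp_apply, AlgHom.toLinearMap_apply, hft, map_smul]
    rfl
  have hB : ∀ z, f ((Bplus k).lTensor (HK k) z) = Bplus k (f z) := fun z => by
    have : f.toLinearMap ∘ₗ (Bplus k).lTensor (HK k) = Bplus k ∘ₗ f.toLinearMap :=
      TensorProduct.ext' fun x y => by
        simp only [LinearMap.comp_apply, LinearMap.lTensor_tmul, AlgHom.toLinearMap_apply, hft,
          map_smul]
    exact LinearMap.congr_fun this z
  have h : f.comp (coproduct k) = AlgHom.id k _ := HK.algHom_ext fun u hu => by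
    rw [AlgHom.comp_apply] at hu ⊢
    rw [coproduct_X, map_add, hB, hu, hft, counit_X, zero_smul, zero_add]
    exact Bplus_forest u
  rw [hf]
  exact congrArg φ (DFunLike.congr_fun h x)

theorem coeff_productMap (f g : HK k →ₐ[k] PowerSeries k) (n : ℕ) (z : HK k ⊗[k] HK k) :
    PowerSeries.coeff n (Algebra.TensorProduct.productMap f g z) =
      ∑ p ∈ Finset.HasAntidiagonal.antidiagonal n, tensorPair (PowerSeries.coeff (R := k) p.1 ∘ₗ f.toLinearMap)
        (PowerSeries.coeff (R := k) p.2 ∘ₗ g.toLinearMap) z := by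
  induction z with
  | zero => simp
  | add z z' h h' => simp only [map_add, h, h', Finset.sum_add_distrib]
  | tmul x y =>
    rw [Algebra.TensorProduct.productMap_apply_tmul, PowerSeries.coeff_mul]
    rfl

/-- The characters are convolution inverse. Both sides are homomorphisms, and on `B₊(u)` the
convolution is `(-y)^(|u|+1) + (-y)^|u| · y = 0`. -/
theorem productMap_kappaChar_epsilonChar (x : HK k) :
    Algebra.TensorProduct.productMap (kappaChar k) (epsilonChar k) (coproduct k x) =
      algebraMap k _ (counit k x) := by
  let f := Algebra.TensorProduct.productMap (kappaChar k) (epsilonChar k)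
  have hB : ∀ z, f ((Bplus k).lTensor (HK k) z) =
      kappaChar k (contractRight (counit k).toLinearMap z) * PowerSeries.X := fun z => by
    induction z with
    | zero => simp
    | add z z' h h' => rw [map_add, map_add, h, h', map_add, map_add, add_mul]
    | tmul x y =>
      rw [LinearMap.lTensor_tmul, contractRight_tmul, map_smul]
      change kappaChar k x * epsilonChar k (Bplus k y) = _
      rw [epsilonChar_Bplus, mul_smul_comm, smul_mul_assoc]
      rfl
  suffices h : f.comp (coproduct k) = (Algebra.ofId k _).comp (counit k) from
    DFunLike.congr_fun h x
  refine HK.algHom_ext fun u _ => ?_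
  rw [AlgHom.comp_apply, AlgHom.comp_apply, coproduct_X, map_add, hB,
    contractRight_counit_coproduct, kappaChar_forest, counit_X, map_zero]
  change kappaChar k _ * epsilonChar k 1 + _ = 0
  rw [map_one, mul_one, kappaChar, MvPolynomial.aeval_X, RTree.size_Bplus, pow_succ]
  ring

theorem tensorPair_smul_left (c : k) (φ ψ : HK k →ₗ[k] k) (z : HK k ⊗[k] HK k) :
    tensorPair (c • φ) ψ z = c * tensorPair φ ψ z := by
  rw [← apply_contractRight, ← apply_contractRight, LinearMap.smul_apply, smul_eq_mul]

/-- `εₙ` is the functional that is `1` on the forest of `n` one-vertex trees and vanishes on the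
other forests. -/
theorem pairL_epsilon [CharZero k] (n : ℕ) :
    pairL k (epsilon k n) = PowerSeries.coeff (R := k) n ∘ₗ (epsilonChar k).toLinearMap := by
  induction n using Nat.strong_induction_on with
  | _ n ih =>
  refine LinearMap.ext fun x => ?_
  cases n with
  | zero =>
    rw [epsilon, pairL_bullet]
    suffices h : (counit k).toLinearMap =
        PowerSeries.coeff (R := k) 0 ∘ₗ (epsilonChar k).toLinearMap from
      LinearMap.congr_fun h x
    refine HK.linearMap_ext fun u => ?_
    change counit k (forest k u) = PowerSeries.coeff 0 (epsilonChar k (forest k u))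
    induction u using Multiset.induction with
    | empty => simp [forest_zero]
    | cons b u _ =>
      rw [forest_cons, map_mul, map_mul, counit_X, zero_mul,
        ← RTree.Bplus_children b, epsilonChar_X, smul_mul_assoc, map_smul, mul_comm,
        PowerSeries.coeff_zero_mul_X, smul_zero]
  | succ n =>
    -- The coefficient of `yⁿ⁺¹` in the convolution identity is the recursion for `εₙ₊₁`; the term
    -- of `κ₀` contributes the character coefficient itself and is isolated.
    have h := congrArg (PowerSeries.coeff (n + 1)) (productMap_kappaChar_epsilonChar x)
    rw [coeff_productMap, Finset.Nat.sum_antidiagonal_succ, coeff_kappaChar, pow_zero, one_smul,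
      Finset.Nat.sum_antidiagonal_eq_sum_range_succ_mk, Finset.sum_range] at h
    have h0 : pairL k (kappa k 0) = (counit k).toLinearMap := by
      classical
      refine HK.linearMap_ext fun u => ?_
      rw [pairL_kappa_forest, AlgHom.toLinearMap_apply, counit_forest]
      refine if_congr ⟨fun h => ?_, ?_⟩ rfl rfl
      · refine Multiset.eq_zero_of_forall_notMem fun t ht => ?_
        have := Multiset.sum_eq_zero_iff.1 h t.size (Multiset.mem_map_of_mem _ ht)
        rw [← RTree.Bplus_children t, RTree.size_Bplus] at this
        omega
      · rintro rfl
        rfl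
    rw [h0, tensorPair_counit_coproduct] at h
    have hc : PowerSeries.coeff (n + 1) (algebraMap k (PowerSeries k) (counit k x)) = 0 := by
      rw [PowerSeries.algebraMap_apply, PowerSeries.coeff_C, if_neg n.succ_ne_zero]
    rw [hc] at h
    rw [eq_neg_of_add_eq_zero_left h, epsilon, map_sum, LinearMap.sum_apply,
      ← Finset.sum_neg_distrib]
    refine Finset.sum_congr rfl fun i _ => ?_
    rw [map_smul, LinearMap.smul_apply, pairL_gl, ih (n - i) (by omega), coeff_kappaChar,
      tensorPair_smul_left, smul_eq_mul, pow_succ]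
    ring

theorem NSym.Z_E_nil : Z k (NSym.E k []) = Finsupp.single RTree.bullet 1 := by
  simp [Z, NSym.E]

/-- `Z` is built from left multiplications, so the factors nest to the right and associativity of
the Grossman–Larson product is not needed. -/
theorem NSym.Z_E_cons (n : ℕ+) (I : Comp) :
    Z k (NSym.E k (n :: I)) = gl k (epsilon k n) (Z k (NSym.E k I)) := by
  simp [Z, NSym.E]

end

end ConnesKreimer
end
noncomputable section
namespace ConnesKreimer

open scoped TensorProduct

/-! ## Separation of the first variable of a quasi-symmetric function -/

/-- The exponent `(a, d₀, d₁, …)`. -/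
def consExp (a : ℕ) (d : ℕ →₀ ℕ) : ℕ →₀ ℕ :=
  Finsupp.single 0 a + d.embDomain ⟨Nat.succ, Nat.succ_injective⟩

theorem consExp_zero (a : ℕ) (d : ℕ →₀ ℕ) : consExp a d 0 = a := by
  rw [consExp, Finsupp.add_apply, Finsupp.single_eq_same, Finsupp.embDomain_of_notMem_range,
    add_zero]
  rintro ⟨n, hn⟩
  exact Nat.succ_ne_zero n hn

theorem consExp_succ (a : ℕ) (d : ℕ →₀ ℕ) (i : ℕ) : consExp a d (i + 1) = d i := by
  rw [consExp, Finsupp.add_apply, Finsupp.single_eq_of_ne (Nat.succ_ne_zero i), zero_add]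
  exact Finsupp.embDomain_apply_self ⟨Nat.succ, Nat.succ_injective⟩ d i

theorem consExp_ext {a : ℕ} {d e : ℕ →₀ ℕ} (h0 : e 0 = a) (h1 : ∀ i, e (i + 1) = d i) :
    consExp a d = e := by
  ext i
  cases i with
  | zero => rw [consExp_zero, h0]
  | succ i => rw [consExp_succ, h1]

theorem consExp_injective {a b : ℕ} {d e : ℕ →₀ ℕ} (h : consExp a d = consExp b e) :
    a = b ∧ d = e := by
  refine ⟨?_, Finsupp.ext fun i => ?_⟩
  · rw [← consExp_zero a d, h, consExp_zero]
  · rw [← consExp_succ a d, h, consExp_succ]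

theorem consExp_add (a b : ℕ) (d e : ℕ →₀ ℕ) :
    consExp (a + b) (d + e) = consExp a d + consExp b e :=
  consExp_ext (by rw [Finsupp.add_apply, consExp_zero, consExp_zero]) fun i => by
    rw [Finsupp.add_apply, Finsupp.add_apply, consExp_succ, consExp_succ]

theorem consExp_zero_zero : consExp 0 0 = 0 := consExp_ext rfl fun _ => rfl

theorem exists_eq_consExp (e : ℕ →₀ ℕ) : ∃ a d, e = consExp a d :=
  ⟨e 0, e.comapDomain Nat.succ Nat.succ_injective.injOn, (consExp_ext rfl fun _ => rfl).symm⟩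

theorem degree_le_degree_consExp (a : ℕ) (d : ℕ →₀ ℕ) : d.degree ≤ (consExp a d).degree := by
  rw [consExp, map_add]
  refine le_trans (le_of_eq ?_) (Nat.le_add_left _ _)
  rw [Finsupp.degree_apply, Finsupp.degree_apply, Finsupp.support_embDomain, Finset.sum_map]
  exact Finset.sum_congr rfl fun i _ => (Finsupp.embDomain_apply_self _ d i).symm

/-- The embedding of `l + 1` indices that maps `0` to `0` and `i + 1` to `n i + 1`. -/
def succEmb {l : ℕ} (n : Fin l ↪o ℕ) : Fin (l + 1) ↪o ℕ :=
  OrderEmbedding.ofStrictMono (Fin.cons 0 fun i => n i + 1) fun i j hij => by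
    cases j using Fin.cases with
    | zero => exact absurd hij (Fin.not_lt_zero i)
    | succ j =>
      cases i using Fin.cases with
      | zero => simp
      | succ i => simpa using hij

theorem succEmb_zero {l : ℕ} (n : Fin l ↪o ℕ) : succEmb n 0 = 0 := rfl

theorem succEmb_succ {l : ℕ} (n : Fin l ↪o ℕ) (i : Fin l) : succEmb n i.succ = n i + 1 := rfl

theorem consExp_expAt {l : ℕ} (a : ℕ) (d : Fin l →₀ ℕ) (n : Fin l ↪o ℕ) :
    consExp a (expAt d n) = expAt (d.cons a) (succEmb n) := by
  refine consExp_ext ?_ fun i => ?_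
  · rw [← succEmb_zero n, expAt_apply, Finsupp.cons_zero]
  · by_cases h : ∃ j, n j = i
    · obtain ⟨j, rfl⟩ := h
      rw [← succEmb_succ, expAt_apply, expAt_apply, Finsupp.cons_succ]
    · rw [expAt, expAt, Finsupp.embDomain_of_notMem_range, Finsupp.embDomain_of_notMem_range]
      · exact h
      · rintro ⟨j, hj⟩
        cases j using Fin.cases with
        | zero => exact Nat.succ_ne_zero i hj.symm
        | succ j => exact h ⟨j, Nat.succ_injective hj⟩

theorem exponents_cons (n : ℕ+) (I : Comp) :
    Comp.exponents (n :: I) = I.exponents.cons (n : ℕ) := by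
  ext j
  cases j using Fin.cases <;> rfl

/-- The first entry and the tail of an exponent split independently; this makes separating the first
variable multiplicative. -/
theorem sum_antidiagonal_consExp {M : Type*} [AddCommMonoid M] (a : ℕ) (d : ℕ →₀ ℕ)
    (F : (ℕ →₀ ℕ) → (ℕ →₀ ℕ) → M) :
    ∑ p ∈ Finset.HasAntidiagonal.antidiagonal (consExp a d), F p.1 p.2 =
      ∑ p ∈ Finset.HasAntidiagonal.antidiagonal a, ∑ q ∈ Finset.HasAntidiagonal.antidiagonal d,
        F (consExp p.1 q.1) (consExp p.2 q.2) := by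
  rw [← Finset.sum_product']
  symm
  refine Finset.sum_bij (fun x _ => (consExp x.1.1 x.2.1, consExp x.1.2 x.2.2)) ?_ ?_ ?_ ?_
  · rintro ⟨p, q⟩ h
    rw [Finset.mem_product, Finset.HasAntidiagonal.mem_antidiagonal,
      Finset.HasAntidiagonal.mem_antidiagonal] at h
    rw [Finset.HasAntidiagonal.mem_antidiagonal, ← consExp_add, h.1, h.2]
  · rintro ⟨⟨p, p'⟩, q, q'⟩ - ⟨⟨r, r'⟩, s, s'⟩ - h
    obtain ⟨h1, h2⟩ := Prod.mk.inj h
    obtain ⟨rfl, rfl⟩ := consExp_injective h1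
    obtain ⟨rfl, rfl⟩ := consExp_injective h2
    rfl
  · rintro ⟨e, e'⟩ h
    obtain ⟨p, q, rfl⟩ := exists_eq_consExp e
    obtain ⟨p', q', rfl⟩ := exists_eq_consExp e'
    rw [Finset.HasAntidiagonal.mem_antidiagonal, ← consExp_add] at h
    obtain ⟨h1, h2⟩ := consExp_injective h
    refine ⟨⟨(p, p'), q, q'⟩, ?_, rfl⟩
    rw [Finset.mem_product, Finset.HasAntidiagonal.mem_antidiagonal,
      Finset.HasAntidiagonal.mem_antidiagonal]
    exact ⟨h1, h2⟩
  · exact fun _ _ => rfl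

namespace QSym

variable (k : Type*) [Field k]

/-- The coefficient of `yᵃ` in `f(y, x₀, x₁, …)`. -/
def shift (a : ℕ) : QSym k →ₗ[k] QSym k where
  toFun f := ⟨fun d => MvPowerSeries.coeff (consExp a d) (f : MvPowerSeries ℕ k), by
    obtain ⟨⟨N, hN⟩, hf⟩ := f.2
    exact ⟨⟨N, fun d hd => (degree_le_degree_consExp a d).trans (hN _ hd)⟩, fun l d n n' => by
      change MvPowerSeries.coeff (consExp a (expAt d n)) _ =
        MvPowerSeries.coeff (consExp a (expAt d n')) _
      -- Both exponents become `(a, d)` at two increasing sequences of positions. Here `a` may be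
      -- `0`, which the definition of `QSym` allows.
      rw [consExp_expAt, consExp_expAt]
      exact hf _ _ _ _⟩⟩
  map_add' f g := Subtype.ext <| MvPowerSeries.ext fun d =>
    map_add (MvPowerSeries.coeff (R := k) (consExp a d)) (f : MvPowerSeries ℕ k) g
  map_smul' c f := Subtype.ext <| MvPowerSeries.ext fun d =>
    map_smul (MvPowerSeries.coeff (R := k) (consExp a d)) c (f : MvPowerSeries ℕ k)

variable {k}

theorem coeff_shift (a : ℕ) (f : QSym k) (d : ℕ →₀ ℕ) :
    MvPowerSeries.coeff d (shift k a f : MvPowerSeries ℕ k) =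
      MvPowerSeries.coeff (consExp a d) (f : MvPowerSeries ℕ k) := rfl

theorem coeffM_apply (I : Comp) (f : QSym k) (n : Fin I.length ↪o ℕ) :
    coeffM k I f = MvPowerSeries.coeff (expAt I.exponents n) (f : MvPowerSeries ℕ k) :=
  f.2.2 _ _ _ _

theorem coeffM_shift (I : Comp) (n : ℕ+) (f : QSym k) :
    coeffM k I (shift k n f) = coeffM k (n :: I) f := by
  rw [coeffM_apply I _ (Fin.valOrderEmb _), coeff_shift, consExp_expAt, ← exponents_cons]
  exact (coeffM_apply (n :: I) f _).symm

/-- Setting `y = 0` only renumbers the variables, `f(0, x₀, x₁, …) = f(x₀, x₁, …)`, by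
quasi-symmetry. -/
theorem shift_zero (f : QSym k) : shift k 0 f = f := by
  refine ext_coeffM fun I => ?_
  rw [coeffM_apply I _ (Fin.valOrderEmb _), coeff_shift,
    coeffM_apply I f ((Fin.valOrderEmb _).trans (OrderEmbedding.ofStrictMono Nat.succ
      fun _ _ h => Nat.succ_lt_succ h))]
  congr 2
  refine consExp_ext ?_ fun i => ?_
  · refine Finsupp.embDomain_of_notMem_range _ _ _ ?_
    rintro ⟨j, hj⟩
    exact Nat.succ_ne_zero _ hj
  · by_cases h : ∃ j, Fin.valOrderEmb I.length j = i
    · obtain ⟨j, rfl⟩ := h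
      rw [expAt_apply]
      exact expAt_apply I.exponents _ j
    · rw [expAt, expAt, Finsupp.embDomain_of_notMem_range, Finsupp.embDomain_of_notMem_range]
      · exact h
      · rintro ⟨j, hj⟩
        exact h ⟨j, Nat.succ_injective hj⟩

theorem coe_M_nil : M k [] = 1 := by
  refine Subtype.ext (MvPowerSeries.ext fun d => ?_)
  classical
  change MvPowerSeries.coeff d (monomialSeries k []) = MvPowerSeries.coeff d 1
  rw [coeff_monomialSeries, MvPowerSeries.coeff_one]
  have h : ∀ n, expAt (Comp.exponents []) n = 0 := fun n => by
    rw [← Finsupp.support_eq_empty, support_expAt]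
    rfl
  refine if_congr ⟨fun ⟨n, hn⟩ => hn.trans (h n), fun hd => ⟨Fin.valOrderEmb _, ?_⟩⟩ rfl rfl
  rw [hd, h]

/-- The homomorphism `f ↦ f(y, x₀, x₁, …)`. -/
def separate : QSym k →ₐ[k] PowerSeries (QSym k) :=
  AlgHom.ofLinearMap
    { toFun := fun f => PowerSeries.mk fun a => shift k a f
      map_add' := fun f g => PowerSeries.ext fun a => by simp
      map_smul' := fun c f => PowerSeries.ext fun a => by simp }
    (PowerSeries.ext fun a => by
      classical
      change PowerSeries.coeff a (PowerSeries.mk fun a => shift k a 1) = _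
      rw [PowerSeries.coeff_mk, PowerSeries.coeff_one]
      refine Subtype.ext (MvPowerSeries.ext fun d => ?_)
      rw [coeff_shift]
      change MvPowerSeries.coeff (consExp a d) 1 = _
      rw [MvPowerSeries.coeff_one]
      by_cases ha : a = 0
      · subst ha
        rw [if_pos rfl]
        change _ = MvPowerSeries.coeff d 1
        rw [MvPowerSeries.coeff_one]
        refine if_congr ⟨fun h => ?_, ?_⟩ rfl rfl
        · exact (consExp_injective (h.trans consExp_zero_zero.symm)).2
        · rintro rfl
          exact consExp_zero_zero
      · rw [if_neg ha, if_neg fun h => ha (consExp_injective (h.trans consExp_zero_zero.symm)).1]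
        rfl)
    (fun f g => PowerSeries.ext fun a => by
      classical
      change PowerSeries.coeff a (PowerSeries.mk fun a => shift k a (f * g)) =
        PowerSeries.coeff a ((PowerSeries.mk fun a => shift k a f) *
          PowerSeries.mk fun a => shift k a g)
      rw [PowerSeries.coeff_mk, PowerSeries.coeff_mul]
      refine Subtype.ext (MvPowerSeries.ext fun d => ?_)
      rw [coeff_shift, AddSubmonoidClass.coe_finsetSum, map_sum]
      change MvPowerSeries.coeff (consExp a d) ((f : MvPowerSeries ℕ k) * (g : MvPowerSeries ℕ k)) = _
      rw [MvPowerSeries.coeff_mul, sum_antidiagonal_consExp a d fun d e =>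
        MvPowerSeries.coeff d (f : MvPowerSeries ℕ k) * MvPowerSeries.coeff e g]
      refine Finset.sum_congr rfl fun p _ => ?_
      rw [PowerSeries.coeff_mk, PowerSeries.coeff_mk]
      change _ = MvPowerSeries.coeff d
        ((shift k p.1 f : MvPowerSeries ℕ k) * (shift k p.2 g : MvPowerSeries ℕ k))
      rw [MvPowerSeries.coeff_mul]
      rfl)

theorem coeff_separate (a : ℕ) (f : QSym k) :
    PowerSeries.coeff a (separate f) = shift k a f :=
  PowerSeries.coeff_mk a fun a => shift k a f

theorem alphaPlus_M (I : Comp) : alphaPlus k (M k I) = M k (I ++ [1]) := by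
  rw [← basis_apply, alphaPlus, Module.Basis.constr_basis]

theorem shift_M_nil (a : ℕ+) : shift k a (M k []) = 0 :=
  ext_coeffM fun I => by rw [coeffM_shift, coeffM_M, if_neg (List.cons_ne_nil _ _), map_zero]

theorem shift_M_cons (a b : ℕ+) (I : Comp) :
    shift k a (M k (b :: I)) = if a = b then M k I else 0 :=
  ext_coeffM fun J => by
    rw [coeffM_shift, coeffM_M, apply_ite (coeffM k J), coeffM_M, map_zero, ← ite_and]
    exact if_congr List.cons_eq_cons rfl rfl

/-- Removing the first part commutes with appending a last part `1`, except on the empty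
composition, where the appended part is also the first; this is the correction at `a = 1`. -/
theorem shift_alphaPlus (a : ℕ) (f : QSym k) :
    shift k a (alphaPlus k f) =
      alphaPlus k (shift k a f) + (if a = 1 then coeffM k [] f else 0) • M k [] := by
  obtain rfl | ha := Nat.eq_zero_or_pos a
  · rw [shift_zero, shift_zero, if_neg Nat.zero_ne_one, zero_smul, add_zero]
  lift a to ℕ+ using ha
  suffices h : shift k a ∘ₗ alphaPlus k = alphaPlus k ∘ₗ shift k a +
      (if (a : ℕ) = 1 then coeffM k [] else 0).smulRight (M k []) by
    have := LinearMap.congr_fun h f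
    rw [LinearMap.add_apply, LinearMap.smulRight_apply] at this
    split_ifs at this ⊢ <;> exact this
  refine (basis k).ext fun I => ?_
  rw [LinearMap.add_apply, LinearMap.smulRight_apply, LinearMap.comp_apply, LinearMap.comp_apply,
    basis_apply, alphaPlus_M]
  cases I with
  | nil =>
    rw [shift_M_nil, map_zero, zero_add, List.nil_append, shift_M_cons]
    have h1 : (a : ℕ) = 1 ↔ a = 1 := PNat.coe_eq_one_iff
    by_cases h : a = 1
    · rw [if_pos h, if_pos (h1.2 h), coeffM_M, if_pos rfl, one_smul]
    · rw [if_neg h, if_neg (h1.not.2 h), LinearMap.zero_apply, zero_smul]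
  | cons b I =>
    have h0 : (if (a : ℕ) = 1 then coeffM k [] else 0) (M k (b :: I)) = 0 := by
      split_ifs
      · rw [coeffM_M, if_neg (List.cons_ne_nil _ _).symm]
      · rfl
    rw [h0, zero_smul, add_zero, List.cons_append, shift_M_cons, shift_M_cons,
      apply_ite (alphaPlus k), alphaPlus_M, map_zero]

theorem coeffM_nil_alphaPlus (f : QSym k) : coeffM k [] (alphaPlus k f) = 0 := by
  suffices h : coeffM k [] ∘ₗ alphaPlus k = 0 from LinearMap.congr_fun h f
  refine (basis k).ext fun I => ?_
  rw [LinearMap.comp_apply, basis_apply, alphaPlus_M, coeffM_M, if_neg (by simp),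
    LinearMap.zero_apply]

theorem coeffM_alphaPlus (I : Comp) (f : QSym k) :
    coeffM k (I ++ [1]) (alphaPlus k f) = coeffM k I f := by
  suffices h : coeffM k (I ++ [1]) ∘ₗ alphaPlus k = coeffM k I from LinearMap.congr_fun h f
  refine (basis k).ext fun J => ?_
  rw [LinearMap.comp_apply, basis_apply, alphaPlus_M, coeffM_M, coeffM_M]
  exact if_congr (List.append_left_inj _) rfl rfl

theorem exists_of_coeffM_alphaPlus_ne_zero (J : Comp) (f : QSym k)
    (h : coeffM k J (alphaPlus k f) ≠ 0) : ∃ I, J = I ++ [1] := by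
  by_contra hJ
  refine h ?_
  suffices h : coeffM k J ∘ₗ alphaPlus k = 0 from LinearMap.congr_fun h f
  refine (basis k).ext fun I => ?_
  rw [LinearMap.comp_apply, basis_apply, alphaPlus_M, coeffM_M, if_neg fun h => hJ ⟨I, h⟩,
    LinearMap.zero_apply]

theorem basis_repr (f : QSym k) (I : Comp) : (basis k).repr f I = coeffM k I f := by
  suffices h : Finsupp.lapply I ∘ₗ (basis k).repr.toLinearMap = coeffM k I from
    LinearMap.congr_fun h f
  refine (basis k).ext fun J => ?_
  rw [LinearMap.comp_apply, LinearEquiv.coe_coe, Module.Basis.repr_self, Finsupp.lapply_apply,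
    Finsupp.single_apply, basis_apply, coeffM_M]
  exact if_congr eq_comm rfl rfl

/-! ### Homogeneous quasi-symmetric functions -/

/-- A quasi-symmetric function is homogeneous of degree `n` if only monomials of degree `n`
occur in it. -/
def IsHomogeneous (f : QSym k) (n : ℕ) : Prop :=
  ∀ d, MvPowerSeries.coeff d (f : MvPowerSeries ℕ k) ≠ 0 → d.degree = n

/-- Monomials suit products, coordinates in the `M_I` suit `α₊`; this passes between them. -/
theorem isHomogeneous_iff {f : QSym k} {n : ℕ} :
    IsHomogeneous f n ↔ ∀ I, coeffM k I f ≠ 0 → Comp.weight I = n := by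
  constructor
  · intro h I hI
    rw [← degree_exponents, ← degree_expAt I.exponents (Fin.valOrderEmb _)]
    exact h _ hI
  · intro h d hd
    obtain ⟨I, n, rfl⟩ := exists_expAt d
    rw [← coeffM_apply] at hd
    rw [degree_expAt, degree_exponents, h I hd]

theorem IsHomogeneous.one : IsHomogeneous (1 : QSym k) 0 := fun d hd => by
  classical
  change MvPowerSeries.coeff d (1 : MvPowerSeries ℕ k) ≠ 0 at hd
  rw [MvPowerSeries.coeff_one] at hd
  rw [of_not_not fun h => hd (if_neg h), map_zero]

theorem IsHomogeneous.mul {f g : QSym k} {n m : ℕ} (hf : IsHomogeneous f n)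
    (hg : IsHomogeneous g m) : IsHomogeneous (f * g) (n + m) := fun d hd => by
  change MvPowerSeries.coeff d ((f : MvPowerSeries ℕ k) * (g : MvPowerSeries ℕ k)) ≠ 0 at hd
  rw [MvPowerSeries.coeff_mul] at hd
  obtain ⟨p, hp, hne⟩ := Finset.exists_ne_zero_of_sum_ne_zero hd
  rw [← Finset.HasAntidiagonal.mem_antidiagonal.1 hp, map_add, hf _ (left_ne_zero_of_mul hne),
    hg _ (right_ne_zero_of_mul hne)]

theorem IsHomogeneous.alphaPlus {f : QSym k} {n : ℕ} (hf : IsHomogeneous f n) :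
    IsHomogeneous (alphaPlus k f) (n + 1) := by
  rw [isHomogeneous_iff] at hf ⊢
  intro J hJ
  obtain ⟨I, rfl⟩ := exists_of_coeffM_alphaPlus_ne_zero J f hJ
  rw [coeffM_alphaPlus] at hJ
  rw [← hf I hJ]
  simp [Comp.weight]

end QSym

/-! ## Zhao's homomorphism and its dual -/

section

variable {k : Type*} [Field k]

/-- The homomorphism from the Connes–Kreimer algebra to the quasi-symmetric functions that
intertwines `B₊` and `α₊`. -/
def toQSym (k : Type*) [Field k] : HK k →ₐ[k] QSym k := initialHom (alphaPlus k)

theorem isHomogeneous_toQSym (u : Multiset RTree) :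
    QSym.IsHomogeneous (toQSym k (forest k u)) (u.map RTree.size).sum := by
  have hf : ∀ u : Multiset RTree,
      (∀ t ∈ u, QSym.IsHomogeneous (toQSym k (MvPolynomial.X t)) t.size) →
      QSym.IsHomogeneous (toQSym k (forest k u)) (u.map RTree.size).sum := by
    intro u
    induction u using Multiset.induction with
    | empty =>
      intro _
      rw [forest_zero, map_one]
      exact QSym.IsHomogeneous.one
    | cons t u ih =>
      intro h
      rw [forest_cons, map_mul, Multiset.map_cons, Multiset.sum_cons]
      exact QSym.IsHomogeneous.mul (h t (Multiset.mem_cons_self t u))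
        (ih fun s hs => h s (Multiset.mem_cons_of_mem hs))
  refine hf u fun t _ => ?_
  clear! u
  induction t using RTree.Bplus_induction with
  | h u ih =>
    rw [toQSym, initialHom_X, RTree.size_Bplus]
    exact QSym.IsHomogeneous.alphaPlus (hf u ih)

/-- The coefficient of `M_[]` is the constant term, hence multiplicative, and it vanishes on the
image of `α₊`, hence on every tree. -/
theorem coeffM_nil_toQSym (x : HK k) : QSym.coeffM k [] (toQSym k x) = counit k x := by
  classical
  have h1 : ∀ f g : QSym k,
      QSym.coeffM k [] (f * g) = QSym.coeffM k [] f * QSym.coeffM k [] g := fun f g => by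
    have h : ∀ f : QSym k, QSym.coeffM k [] f =
        MvPowerSeries.constantCoeff (f : MvPowerSeries ℕ k) := by
      intro f
      have h0 : expAt (Comp.exponents []) (Fin.valOrderEmb _) = 0 := by
        rw [← Finsupp.support_eq_empty, support_expAt]
        rfl
      rw [QSym.coeffM_apply _ _ (Fin.valOrderEmb _), h0]
      rfl
    rw [h, h, h, ← map_mul]
    rfl
  suffices h : QSym.coeffM k [] ∘ₗ (toQSym k).toLinearMap = (counit k).toLinearMap from
    LinearMap.congr_fun h x
  refine HK.linearMap_ext fun u => ?_
  rw [LinearMap.comp_apply, AlgHom.toLinearMap_apply, AlgHom.toLinearMap_apply]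
  induction u using Multiset.induction with
  | empty => rw [forest_zero, map_one (toQSym k), map_one (counit k), ← QSym.coe_M_nil, QSym.coeffM_M, if_pos rfl]
  | cons t u _ =>
    rw [forest_cons, map_mul (toQSym k), map_mul (counit k), h1, counit_X, zero_mul, ← RTree.Bplus_children t, toQSym,
      initialHom_X, QSym.coeffM_nil_alphaPlus, zero_mul]

/-- The map `x ⊗ y ↦ ε(x) ρ(y)` with the generating function `ε` of the `εₙ`. -/
def epsilonTensor (k : Type*) [Field k] : HK k ⊗[k] HK k →ₐ[k] PowerSeries (QSym k) :=
  Algebra.TensorProduct.productMap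
    ((PowerSeries.mapAlgHom (Algebra.ofId k (QSym k))).comp (epsilonChar k))
    ((Algebra.ofId (QSym k) (PowerSeries (QSym k))).restrictScalars k |>.comp (toQSym k))

theorem coeff_epsilonTensor_tmul (n : ℕ) (x y : HK k) :
    PowerSeries.coeff n (epsilonTensor k (x ⊗ₜ y)) =
      PowerSeries.coeff n (epsilonChar k x) • toQSym k y := by
  rw [epsilonTensor, Algebra.TensorProduct.productMap_apply_tmul]
  change PowerSeries.coeff n
    (PowerSeries.map (algebraMap k (QSym k)) (epsilonChar k x) * PowerSeries.C (toQSym k y)) = _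
  rw [PowerSeries.coeff_mul_C, PowerSeries.coeff_map, Algebra.smul_def]

theorem coeff_epsilonTensor_Bplus (n : ℕ) (z : HK k ⊗[k] HK k) :
    PowerSeries.coeff n (epsilonTensor k ((Bplus k).lTensor (HK k) z)) =
      alphaPlus k (PowerSeries.coeff n (epsilonTensor k z)) := by
  induction z with
  | zero => simp
  | add z z' h h' => simp only [map_add, h, h']
  | tmul x y =>
    rw [LinearMap.lTensor_tmul, coeff_epsilonTensor_tmul, coeff_epsilonTensor_tmul, map_smul,
      toQSym, initialHom_Bplus]

/-- Along `B₊`, the correction term of `QSym.shift_alphaPlus` is the constant term of `toQSym u`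
times `y`. It matches the contribution of `B₊(u) ⊗ 1` in the coproduct, since `ε(B₊(u))` is the
counit of `u` times `y`; the terms with `α₊` and with `id ⊗ B₊` match by induction. -/
theorem separate_toQSym (x : HK k) :
    QSym.separate (toQSym k x) = epsilonTensor k (coproduct k x) := by
  suffices h : QSym.separate.comp (toQSym k) = (epsilonTensor k).comp (coproduct k) from
    DFunLike.congr_fun h x
  refine HK.algHom_ext fun u hu => PowerSeries.ext fun n => ?_
  have hu' := congrArg (PowerSeries.coeff n) hu
  rw [AlgHom.comp_apply, AlgHom.comp_apply, QSym.coeff_separate] at hu' ⊢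
  have h1 : toQSym k (MvPolynomial.X (RTree.Bplus u)) = alphaPlus k (toQSym k (forest k u)) :=
    initialHom_X _ u
  rw [h1, QSym.shift_alphaPlus, hu', coproduct_X, map_add, map_add, coeff_epsilonTensor_Bplus,
    coeff_epsilonTensor_tmul, epsilonChar_X, coeffM_nil_toQSym, map_one, map_smul,
    PowerSeries.coeff_X, add_comm, QSym.coe_M_nil, smul_eq_mul, mul_ite, mul_one, mul_zero]

/-- The coefficients of the homomorphism to the quasi-symmetric functions are given by `Z`. -/
theorem coeffM_toQSym [CharZero k] (I : Comp) (x : HK k) :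
    QSym.coeffM k I (toQSym k x) = pairL k (Z k (NSym.E k I)) x := by
  induction I generalizing x with
  | nil => rw [coeffM_nil_toQSym, NSym.Z_E_nil, pairL_bullet]
  | cons n I ih =>
    -- Both sides become functionals of `Δ(x)`: `εₙ` acts on the left factor and the remaining
    -- composition on the right factor.
    rw [← QSym.coeffM_shift, ← QSym.coeff_separate, separate_toQSym, NSym.Z_E_cons, pairL_gl]
    generalize coproduct k x = z
    induction z with
    | zero => simp
    | add z z' h h' => simp only [map_add, h, h']
    | tmul x y =>
      rw [coeff_epsilonTensor_tmul, map_smul, ih, tensorPair_tmul, pairL_epsilon]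
      rfl

/-- The coefficients agree by `coeffM_toQSym`. Since `Zstar` sums only over compositions of weight
`|u|`, the others must have coefficient zero, which is the homogeneity of `toQSym`. -/
theorem Zstar_eq_toQSym [CharZero k] : Zstar k = (toQSym k).toLinearMap := by
  classical
  refine (MvPolynomial.basisMonomials RTree k).ext fun d => ?_
  rw [Zstar, Module.Basis.constr_basis, MvPolynomial.coe_basisMonomials]
  change _ = toQSym k (MvPolynomial.monomial d 1)
  refine QSym.ext_coeffM fun J => ?_
  rw [map_sum]
  simp only [map_smul, QSym.coeffM_M, smul_eq_mul, mul_ite, mul_one, mul_zero]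
  rw [Finset.sum_ite_eq, coeffM_toQSym, pairL_apply]
  split_ifs with h
  · rfl
  · by_contra hne
    rw [← pairL_apply, ← coeffM_toQSym, monomial_eq_forest] at hne
    exact h ((Set.Finite.mem_toFinset _).2
      (QSym.isHomogeneous_iff.1 (isHomogeneous_toQSym _) J (Ne.symm hne)))

theorem basisFreeMonoid_eq_E (w : FreeMonoid ℕ+) :
    FreeAlgebra.basisFreeMonoid k ℕ+ w = NSym.E k w.toList := by
  have h : FreeAlgebra.basisFreeMonoid k ℕ+ w =
      FreeAlgebra.equivMonoidAlgebraFreeMonoid.symm (MonoidAlgebra.single w 1) := by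
    simp [FreeAlgebra.basisFreeMonoid]
  rw [h]
  change MonoidAlgebra.lift k (FreeAlgebra k ℕ+) (FreeMonoid ℕ+)
    (FreeMonoid.lift (FreeAlgebra.ι k)) (MonoidAlgebra.single w 1) = _
  rw [MonoidAlgebra.lift_single, one_smul, FreeMonoid.lift_apply, NSym.E]

theorem pairNQ_Zstar [CharZero k] (P : NSym k) (x : HK k) :
    pairNQ k P (Zstar k x) = pairTree k (Z k P) x := by
  suffices h : (FreeAlgebra.basisFreeMonoid k ℕ+).constr k
      (fun w => (QSym.basis k).repr (Zstar k x) (FreeMonoid.toList w)) =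
      (pairL k).flip x ∘ₗ Z k from LinearMap.congr_fun h P
  refine (FreeAlgebra.basisFreeMonoid k ℕ+).ext fun w => ?_
  rw [Module.Basis.constr_basis, QSym.basis_repr, Zstar_eq_toQSym, AlgHom.toLinearMap_apply,
    coeffM_toQSym, LinearMap.comp_apply, basisFreeMonoid_eq_E]
  rfl

end

end ConnesKreimer
end

/-! ### The theorem, from the universal property and `Z^* = toQSym` -/

theorem mainTheorem2 (k : Type*) [Field k] [CharZero k] :
    (∀ (P : ConnesKreimer.NSym k) (x : ConnesKreimer.HK k),
      ConnesKreimer.pairNQ k P (ConnesKreimer.Zstar k x) =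
        ConnesKreimer.pairTree k (ConnesKreimer.Z k P) x) ∧
    (∀ u : Multiset ConnesKreimer.RTree,
      ConnesKreimer.Zstar k (ConnesKreimer.Bplus k (ConnesKreimer.forest k u)) =
        ConnesKreimer.alphaPlus k (ConnesKreimer.Zstar k (ConnesKreimer.forest k u))) ∧
    (∃ φ : ConnesKreimer.HK k →ₐ[k] ConnesKreimer.QSym k,
      φ.toLinearMap = ConnesKreimer.Zstar k ∧
      ∀ ρ : ConnesKreimer.HK k →ₐ[k] ConnesKreimer.QSym k,
        (∀ u : Multiset ConnesKreimer.RTree,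
          ρ (ConnesKreimer.Bplus k (ConnesKreimer.forest k u)) =
            ConnesKreimer.alphaPlus k (ρ (ConnesKreimer.forest k u))) → ρ = φ) ∧
    (∀ (A : Type*) [CommRing A] [Algebra k A] (L : A →ₗ[k] A),
      ∃! ρ : ConnesKreimer.HK k →ₐ[k] A,
        ∀ x : ConnesKreimer.HK k, ρ (ConnesKreimer.Bplus k x) = L (ρ x)) := by
  refine ⟨ConnesKreimer.pairNQ_Zstar, fun u => ?_,
    ⟨ConnesKreimer.toQSym k, ConnesKreimer.Zstar_eq_toQSym.symm, fun ρ hρ =>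
      ConnesKreimer.eq_initialHom _ ρ hρ⟩, fun A _ _ L =>
    ⟨ConnesKreimer.initialHom L, ConnesKreimer.initialHom_Bplus L, fun ρ hρ =>
      ConnesKreimer.eq_initialHom L ρ fun u => hρ _⟩⟩
  rw [ConnesKreimer.Zstar_eq_toQSym]
  exact ConnesKreimer.initialHom_Bplus _ _
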